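/- **Setting.** Let $(X,Y)$ be a random pair with values in $\mathcal X\times\mathbb R$, $\mathbb E Y^2<\infty$, and let $\mu$ be the law of $X$. Let $V$ be a vector space of measurable, $\mu$-square-integrable functions on $\mathcal X$ (for instance a Sobolev space), $\mathscr D:V\to L_2(\mu)$ linear, $g\in L_2(\mu)$, and $\Psi(f)=\lVert \mathscr D f-g\rVert_{L_2(\mu)}$. Let $\mathscr H\subset V$ and let $\mathscr F$ be the closure in $L_2(\mu)$ of the convex hull of $\mathscr H$. Assume that $\mathscr F$ satisfies the small-ball assumption with constants $\kappa>0$ and $0<\epsilon\le 1$: $$\Pr\big(|f(X)-h(X)|\ge\kappa\lVert f-h\rVert_{L_2(\mu)}\big)\ge\epsilon\qquad\text{for all } f,h\in\mathscr F .$$ Assume also that the minimiser $f^\star$ of $\mathbb E(f(X)-Y)^2$ over $f\in\mathscr F$ belongs to $\mathscr H$. Suprema over $\mathscr F$ are assumed measurable. Put $\xi=f^\star(X)-Y$, let $(X_i,Y_i)_{i\le n}$ be independent copies of $(X,Y)$, $\xi_i=f^\star(X_i)-Y_i$, and let $\varepsilon_1,\dots,\varepsilon_n$ be independent uniform signs,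 independent of the sample. For $\mathscr G\subset V$ write $\mathscr G_r=\{f\in\mathscr G:\lVert f-f^\star\rVert_{L_2(\mu)}\le r\}$ and $$r_Q(\mathscr G,\tau)=\inf\Big\{r>0:\mathbb E\sup_{f\in\mathscr G_r}\Big|\tfrac1n\sum_{i=1}^n\varepsilon_i(f-f^\star)(X_i)\Big|\le\tau r\Big\},$$ $$r_M(\mathscr G,\tau,\delta)=\inf\Big\{s>0:\Pr\Big(\sup_{f\in\mathscr G_s}\Big|\tfrac1{\sqrt n}\sum_{i=1}^n\varepsilon_i\xi_i(f-f^\star)(X_i)\Big|\le\tau s^2\sqrt n\Big)\ge1-\delta\Big\}.$$ For $\rho\ge0$ let $\mathscr F(\rho)=\{f\in\mathscr F\cap V:\Psi(f)-\Psi(f^\star)\le\rho\}$. Fix $\delta\in(0,1)$ and a function $r(\cdot)$ such that, for all $\rho\ge 0$, $$r(\rho)\ge\max\{r_M(\mathscr F(\rho),\kappa^2\epsilon/80,\delta/4),\,r_Q(\mathscr F(\rho),\kappa\epsilon/32)\}.$$ Let $$\mathcal O(\rho)=\sup_{f\in\mathscr F(\rho)_{r(\rho)}}\Big|\tfrac1n\sum_{i=1}^n\xi_i(f-f^\star)(X_i)-\mathbb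 E\,\xi(f-f^\star)(X)\Big|,$$ $$\gamma_{\mathcal O}(\rho,\tau,\delta)=\inf\{z>0:\Pr(\mathcal O(\rho)\le\tau z)\ge1-\delta\},\qquad \lambda_0(\delta,\tau)=\sup_{\rho>0}\gamma_{\mathcal O}(\rho,\tau,\delta)/\rho .$$ **Theorem.** Fix $\rho>2\Psi(f^\star)$, $0<\tau<1/2-\Psi(f^\star)/\rho$ and $\lambda>\lambda_0(\delta,\tau)$. Then, with probability at least $1-2\delta-2\exp(-n\epsilon^2/2)$, every minimiser $\hat h_{n,\Psi}$ over $h\in\mathscr H$ of $\frac1n\sum_{i=1}^n(h(X_i)-Y_i)^2+\lambda\Psi(h)$ satisfies both $$\Psi(\hat h_{n,\Psi})-\Psi(f^\star)\le\rho\qquad\text{and}\qquad \lVert\hat h_{n,\Psi}-f^\star\rVert_{L_2(\mu)}\le\max\Big\{r(\rho),\Big[\tfrac{32}{\kappa^2\epsilon}\lambda\Psi(f^\star)\Big]^{1/2}\Big\}.$$ -/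

import Mathlib

open MeasureTheory ProbabilityTheory
open scoped ENNReal

noncomputable section

namespace PISL

/-- The data of a physics-informed regression problem.  `law` is the joint law of `(X, Y)`; its first
marginal is the distribution of `X`.  `V` is the vector space of (genuine, everywhere defined)
functions on which the linear operator `D` acts, e.g. a Sobolev space, and the physical knowledge is
the linear equation `D u = g` in `L²` of the distribution of `X`. -/
structure Model (𝓧 : Type*) [MeasurableSpace 𝓧] where
  law : Measure (𝓧 × ℝ)
  isProb : IsProbabilityMeasure law
  memLp_response : MemLp (fun z : 𝓧 × ℝ => z.2) 2 law
  V : Submodule ℝ (𝓧 → ℝ)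
  measurable_of_mem : ∀ f ∈ V, Measurable f
  memLp_of_mem : ∀ f ∈ V, MemLp f 2 law.fst
  D : V →ₗ[ℝ] Lp ℝ 2 law.fst
  g : Lp ℝ 2 law.fst

attribute [instance] Model.isProb

namespace Model

variable {𝓧 : Type*} [MeasurableSpace 𝓧] (M : Model 𝓧)

/-- The distribution of `X`. -/
abbrev μ : Measure 𝓧 := M.law.fst

/-- The class in `L²(μ)` of a function of `V`. -/
def toL2 (f : M.V) : Lp ℝ 2 M.μ :=
  (M.memLp_of_mem (f : 𝓧 → ℝ) f.2).toLp (f : 𝓧 → ℝ)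

/-- The penalty `Ψ(f) = ‖D f - g‖` in `L²(μ)`. -/
def Psi (f : M.V) : ℝ := ‖M.D f - M.g‖

/-- The closed convex hull in `L²(μ)` of a class of functions. -/
def hull (H : Set M.V) : Set (Lp ℝ 2 M.μ) :=
  closure (convexHull ℝ (M.toL2 '' H))

/-- The small-ball assumption with constants `κ` and `ε`, for a class in `L²(μ)`. -/
def SmallBall (F : Set (Lp ℝ 2 M.μ)) (κ ε : ℝ) : Prop :=
  ∀ f ∈ F, ∀ h ∈ F, ENNReal.ofReal ε ≤ M.μ {x | κ * ‖f - h‖ ≤ |f x - h x|}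

/-- The mean squared error `E (f(X) - Y)²`. -/
def risk (f : Lp ℝ 2 M.μ) : ℝ := ∫ z, (f z.1 - z.2) ^ 2 ∂M.law

/-- `fstar` is (a version of) the minimiser of the mean squared error over the closed convex hull
of `H`, that is, of the `L²`-projection of `Y`. -/
def IsTarget (H : Set M.V) (fstar : M.V) : Prop :=
  M.toL2 fstar ∈ M.hull H ∧ ∀ f ∈ M.hull H, M.risk (M.toL2 fstar) ≤ M.risk f

/-- The noise `ξ = f*(X) - Y`. -/
def noise (fstar : M.V) (z : 𝓧 × ℝ) : ℝ := (fstar : 𝓧 → ℝ) z.1 - z.2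

/-- The law of a sample of size `n`. -/
def sampleLaw (n : ℕ) : Measure (Fin n → 𝓧 × ℝ) := Measure.pi fun _ => M.law

/-- The joint law of `n` independent random signs and of an independent sample of size `n`.  The
vector of signs is coded by a uniformly distributed vector of booleans. -/
def signSampleLaw (n : ℕ) : Measure ((Fin n → Bool) × (Fin n → 𝓧 × ℝ)) :=
  (PMF.uniformOfFintype (Fin n → Bool)).toMeasure.prod (M.sampleLaw n)

/-- The sign coded by a boolean. -/
def _root_.PISL.sign (b : Bool) : ℝ := if b then 1 else -1

/-- `G ∩ r D_{f*}`: the members of `G` at `L²(μ)`-distance at most `r` from `f*`. -/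
def localClass (G : Set M.V) (fstar : M.V) (r : ℝ≥0∞) : Set M.V :=
  {f | f ∈ G ∧ ‖M.toL2 f - M.toL2 fstar‖ₑ ≤ r}

/-- The supremum over `G ∩ r D_{f*}` of `|n⁻¹ ∑ εᵢ (f - f*)(Xᵢ)|`. -/
def radSup (n : ℕ) (G : Set M.V) (fstar : M.V) (r : ℝ≥0∞)
    (p : (Fin n → Bool) × (Fin n → 𝓧 × ℝ)) : ℝ≥0∞ :=
  ⨆ f ∈ M.localClass G fstar r,
    ‖(n : ℝ)⁻¹ * ∑ i, sign (p.1 i) *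
      ((f : 𝓧 → ℝ) (p.2 i).1 - (fstar : 𝓧 → ℝ) (p.2 i).1)‖ₑ

/-- The complexity `r_Q(G, τ)` (the infimum of the empty set is `∞`). -/
def rQ (n : ℕ) (G : Set M.V) (fstar : M.V) (τ : ℝ) : ℝ≥0∞ :=
  sInf (ENNReal.ofReal '' {r : ℝ | 0 < r ∧
    ∫⁻ p, M.radSup n G fstar (ENNReal.ofReal r) p ∂M.signSampleLaw n ≤ ENNReal.ofReal (τ * r)})

/-- The process `φ_n(G, f*, s)`: the supremum over `G ∩ s D_{f*}` of
`|n^{-1/2} ∑ εᵢ ξᵢ (f - f*)(Xᵢ)|`. -/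
def phi (n : ℕ) (G : Set M.V) (fstar : M.V) (s : ℝ≥0∞)
    (p : (Fin n → Bool) × (Fin n → 𝓧 × ℝ)) : ℝ≥0∞ :=
  ⨆ f ∈ M.localClass G fstar s,
    ‖(√(n : ℝ))⁻¹ * ∑ i, sign (p.1 i) * M.noise fstar (p.2 i) *
      ((f : 𝓧 → ℝ) (p.2 i).1 - (fstar : 𝓧 → ℝ) (p.2 i).1)‖ₑ

/-- The complexity `r_M(G, τ, δ)`. -/
def rM (n : ℕ) (G : Set M.V) (fstar : M.V) (τ δ : ℝ) : ℝ≥0∞ :=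
  sInf (ENNReal.ofReal '' {s : ℝ | 0 < s ∧
    ENNReal.ofReal (1 - δ) ≤ M.signSampleLaw n
      {p | M.phi n G fstar (ENNReal.ofReal s) p ≤ ENNReal.ofReal (τ * s ^ 2 * √(n : ℝ))}})

/-- `F(ρ, Ψ)`: the functions of the closed convex hull of `H` (on which `D` is defined) whose
penalty exceeds that of `f*` by at most `ρ`. -/
def penaltyClass (H : Set M.V) (fstar : M.V) (ρ : ℝ) : Set M.V :=
  {f | M.toL2 f ∈ M.hull H ∧ M.Psi f - M.Psi fstar ≤ ρ}

/-- `O(ρ)`: the supremum of the multiplier process `|P_n M_{f - f*}|` over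
`F(ρ, Ψ) ∩ r(ρ) D_{f*}`. -/
def multSup (n : ℕ) (H : Set M.V) (fstar : M.V) (r : ℝ → ℝ≥0∞) (ρ : ℝ)
    (S : Fin n → 𝓧 × ℝ) : ℝ≥0∞ :=
  ⨆ f ∈ M.localClass (M.penaltyClass H fstar ρ) fstar (r ρ),
    ‖(n : ℝ)⁻¹ * ∑ i, M.noise fstar (S i) *
        ((f : 𝓧 → ℝ) (S i).1 - (fstar : 𝓧 → ℝ) (S i).1)
      - ∫ z, M.noise fstar z * ((f : 𝓧 → ℝ) z.1 - (fstar : 𝓧 → ℝ) z.1) ∂M.law‖ₑ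

/-- `γ_O(ρ, τ, δ)`. -/
def gammaO (n : ℕ) (H : Set M.V) (fstar : M.V) (r : ℝ → ℝ≥0∞) (ρ τ δ : ℝ) : ℝ≥0∞ :=
  sInf (ENNReal.ofReal '' {z : ℝ | 0 < z ∧
    ENNReal.ofReal (1 - δ) ≤
      M.sampleLaw n {S | M.multSup n H fstar r ρ S ≤ ENNReal.ofReal (τ * z)}})

/-- `λ₀(δ, τ)`, for the target `f*` of the problem. -/
def lambda0 (n : ℕ) (H : Set M.V) (fstar : M.V) (r : ℝ → ℝ≥0∞) (δ τ : ℝ) : ℝ≥0∞ :=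
  ⨆ ρ : {ρ : ℝ // 0 < ρ}, M.gammaO n H fstar r ρ τ δ / ENNReal.ofReal ρ

/-- The physics-informed empirical error `n⁻¹ ∑ (h(Xᵢ) - Yᵢ)² + λ Ψ(h)`. -/
def informedLoss (n : ℕ) (lam : ℝ) (S : Fin n → 𝓧 × ℝ) (h : M.V) : ℝ :=
  (n : ℝ)⁻¹ * ∑ i, ((h : 𝓧 → ℝ) (S i).1 - (S i).2) ^ 2 + lam * M.Psi h

/-- `h` is a physics-informed estimator computed from the sample `S`. -/
def IsInformedEstimator (n : ℕ) (H : Set M.V) (lam : ℝ) (S : Fin n → 𝓧 × ℝ) (h : M.V) : Prop :=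
  h ∈ H ∧ ∀ h' ∈ H, M.informedLoss n lam S h ≤ M.informedLoss n lam S h'

/-- The standing convention that suprema over the class are measurable: for every number `m` of
observations, the supremum over the functions `f` of the closed convex hull of `H` of a nonnegative
functional of the observations and of `(f(x₁), …, f(x_m), f, D f)`, measurable in the former and
continuous in the latter, is a measurable function of the observations.  (It holds, for instance,
when some countable subclass approximates every `f` pointwise, in `L²(μ)`, and with its image
under `D`.) -/
def MeasurableSuprema (H : Set M.V) : Prop :=
  ∀ (m : ℕ) (Φ : (Fin m → 𝓧 × ℝ) → (Fin m → ℝ) × Lp ℝ 2 M.μ × Lp ℝ 2 M.μ → ℝ),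
    (∀ v, Measurable fun S => Φ S v) → (∀ S, Continuous (Φ S)) →
    Measurable fun S : Fin m → 𝓧 × ℝ =>
      ⨆ f ∈ {f : M.V | M.toL2 f ∈ M.hull H},
        ENNReal.ofReal (Φ S (fun i => (f : 𝓧 → ℝ) (S i).1, M.toL2 f, M.D f))

end Model

end PISL

end

/-
Write `d = ‖f - f*‖`. On two events of large probability the basic inequality for the minimiser is
decided by two bounds.

Quadratic part. Averages of truncated squares `min(|f - f*|, s)²` of the localised class concentrate
(bounded differences, symmetrization and contraction against `r_Q`), and the small-ball assumption
bounds their mean from below; by star-shapedness, `n⁻¹ ∑ (f - f*)²(Xᵢ) ≥ (κ² ε / 4) d²` once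
`d > r(ρ)`.

Multiplier part. Let `ρ → 0`. If `r(ρ) = O(ρ)` along a sequence, the bounds defining `r_M` at radii
tending to `0` force, by homogeneity, every signed sum of the products `ξᵢ (f - f*)(Xᵢ)` to vanish,
hence the products themselves. Otherwise `r(ρ) / ρ → ∞`, so every `f` shrunk towards `f*` by a small
factor enters the class `F(ρ)_{r(ρ)}`, and convexity of `Ψ` with `λ > λ₀` bounds its multiplier
deviation by `τ λ (Ψ(f) - Ψ(f*))⁺`, while `E ξ (f - f*)(X) ≥ 0` because `f*` is a projection. In
both cases the multiplier term cannot compensate a penalty larger than that of `f*`, so that even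
`Ψ(ĥ) ≤ Ψ(f*)`.
-/

open Filter Finset
open scoped NNReal

universe u

namespace PISL

theorem le_measureReal_limsup {α : Type*} [MeasurableSpace α] {μ : Measure α} [IsFiniteMeasure μ]
    {E : ℕ → Set α} (hE : ∀ k, MeasurableSet (E k)) {c : ℝ} (hc : ∀ k, c ≤ μ.real (E k)) :
    c ≤ μ.real (limsup E atTop) := by
  rw [limsup_eq_iInf_iSup_of_nat]
  refine ge_of_tendsto' ((ENNReal.tendsto_toReal (measure_ne_top _ _)).comp
    (tendsto_measure_iInter_atTop
      (fun m => (MeasurableSet.iUnion fun k => .iUnion fun _ => hE k).nullMeasurableSet)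
      (fun a b hab => Set.iUnion_mono fun k => Set.iUnion_mono' fun hk => ⟨hab.trans hk, le_rfl⟩)
      ⟨0, measure_ne_top _ _⟩)) fun m => (hc m).trans (measureReal_mono ?_)
  exact Set.subset_iUnion₂_of_subset m le_rfl Set.Subset.rfl

theorem continuous_integral_lipschitz_comp {α : Type*} [MeasurableSpace α] {μ : Measure α}
    [IsFiniteMeasure μ] {K : ℝ≥0} {φ : ℝ → ℝ} (hφ : LipschitzWith K φ) (hφ₀ : φ 0 = 0) :
    Continuous fun a : Lp ℝ 2 μ => ∫ x, φ (a x) ∂μ := by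
  have hinner (a : Lp ℝ 2 μ) : ∫ x, φ (a x) ∂μ
      = inner ℝ (indicatorConstLp 2 .univ (measure_ne_top μ _) (1 : ℝ)) (hφ.compLp hφ₀ a) := by
    rw [L2.inner_indicatorConstLp_one, setIntegral_univ]
    exact integral_congr_ae (hφ.coeFn_compLp hφ₀ a).symm
  simp only [hinner]
  exact continuous_const.inner (hφ.continuous_compLp hφ₀)

theorem measureReal_prod_le_of_section_le_half {α β : Type*} [MeasurableSpace α]
    [MeasurableSpace β] {μ : Measure α} {ν : Measure β} [IsProbabilityMeasure μ]
    [IsProbabilityMeasure ν] {U : Set (α × β)} {E : Set β} (hU : MeasurableSet U)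
    (hE : MeasurableSet E) (hsec : ∀ y ∉ E, μ {x | (x, y) ∈ U} ≤ 2⁻¹) :
    (μ.prod ν).real U ≤ (1 + ν.real E) / 2 := by
  have h : μ.prod ν U ≤ ν E + 2⁻¹ * ν Eᶜ := by
    rw [Measure.prod_apply_symm hU, ← lintegral_add_compl _ hE]
    refine add_le_add ?_ ?_
    · exact (lintegral_mono fun y => prob_le_one).trans_eq (setLIntegral_one _)
    · exact (setLIntegral_mono measurable_const hsec).trans_eq (setLIntegral_const _ _)
  have hreal := ENNReal.toReal_mono (by finiteness) h
  rw [ENNReal.toReal_add (by finiteness) (by finiteness), ENNReal.toReal_mul, ENNReal.toReal_inv,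
    ENNReal.toReal_ofNat] at hreal
  have hcompl := probReal_compl_eq_one_sub (μ := ν) hE
  simp only [measureReal_def] at hcompl ⊢
  linarith

theorem one_sub_sub_le_measureReal_inter {Ω : Type*} [MeasurableSpace Ω] {P : Measure Ω}
    [IsProbabilityMeasure P] {A B : Set Ω} {a b : ℝ} (hB : MeasurableSet B)
    (hPA : 1 - a ≤ P.real A) (hPB : 1 - b ≤ P.real B) : 1 - a - b ≤ P.real (A ∩ B) := by
  have hunion : P.real (A ∪ B) ≤ 1 := measureReal_le_one
  linarith [measureReal_union_add_inter (μ := P) (s := A) hB]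

theorem enorm_le_max_of_lt_imp {E : Type*} [SeminormedAddCommGroup E] {x : E} {R : ℝ≥0∞}
    {c K : ℝ} (hc : 0 < c) (h : R < ‖x‖ₑ → c * ‖x‖ ^ 2 ≤ K) :
    ‖x‖ₑ ≤ max R (ENNReal.ofReal √(K / c)) := by
  refine le_max_iff.2 (or_iff_not_imp_left.2 fun hR => ?_)
  rw [← ofReal_norm]
  refine ENNReal.ofReal_le_ofReal (Real.le_sqrt_of_sq_le ?_)
  rw [le_div_iff₀' hc]
  exact h (not_le.1 hR)

section BoundedDifferences

theorem hasSubgaussianMGF_add_prod {α β : Type*} [MeasurableSpace α] [MeasurableSpace β]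
    {μ : Measure α} {ν : Measure β} [SFinite μ] [SFinite ν] {X : α → ℝ} {Y : α × β → ℝ}
    {a b : ℝ≥0} (hX : HasSubgaussianMGF X a μ) (hYm : Measurable Y)
    (hY : ∀ x, HasSubgaussianMGF (fun y => Y (x, y)) b ν) :
    HasSubgaussianMGF (fun p => X p.1 + Y p) (a + b) (μ.prod ν) := by
  have hsplit (t : ℝ) (p : α × β) :
      Real.exp (t * (X p.1 + Y p)) = Real.exp (t * X p.1) * Real.exp (t * Y p) := by
    rw [mul_add, Real.exp_add]
  have hmgf (t : ℝ) (x : α) : ∫ y, Real.exp (t * (X x + Y (x, y))) ∂ν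
      ≤ Real.exp (t * X x) * Real.exp (b * t ^ 2 / 2) := by
    simp only [hsplit t (x, _), integral_const_mul]
    exact mul_le_mul_of_nonneg_left ((hY x).mgf_le t) (Real.exp_nonneg _)
  have hmeas (t : ℝ) :
      AEStronglyMeasurable (fun p : α × β => Real.exp (t * (X p.1 + Y p))) (μ.prod ν) := by
    have hX' := hX.aemeasurable.comp_fst (ν := ν)
    exact ((hX'.add hYm.aemeasurable).const_mul t).exp.aestronglyMeasurable
  have hint (t : ℝ) : Integrable (fun p => Real.exp (t * (X p.1 + Y p))) (μ.prod ν) := by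
    refine (integrable_prod_iff (hmeas t)).2 ⟨.of_forall fun x => ?_, ?_⟩
    · simpa only [hsplit t (x, _)] using ((hY x).integrable_exp_mul t).const_mul _
    · refine ((hX.integrable_exp_mul t).mul_const (Real.exp (b * t ^ 2 / 2))).mono'
        (hmeas t).norm.integral_prod_right'
        (.of_forall fun x => ?_)
      simp only [Real.norm_eq_abs, Real.abs_exp]
      rw [abs_of_nonneg (integral_nonneg fun y => (Real.exp_pos _).le)]
      exact hmgf t x
  refine ⟨hint, fun t => ?_⟩
  calc ∫ p, Real.exp (t * (X p.1 + Y p)) ∂μ.prod ν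
      = ∫ x, ∫ y, Real.exp (t * (X x + Y (x, y))) ∂ν ∂μ := integral_prod _ (hint t)
    _ ≤ ∫ x, Real.exp (t * X x) * Real.exp (b * t ^ 2 / 2) ∂μ :=
      integral_mono (hint t).integral_prod_left ((hX.integrable_exp_mul t).mul_const _) (hmgf t)
    _ = mgf X μ t * Real.exp (b * t ^ 2 / 2) := integral_mul_const _ _
    _ ≤ Real.exp (a * t ^ 2 / 2) * Real.exp (b * t ^ 2 / 2) := by
      gcongr
      exact hX.mgf_le t
    _ = Real.exp ((a + b : ℝ≥0) * t ^ 2 / 2) := by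
      rw [← Real.exp_add, NNReal.coe_add]
      ring_nf

theorem hasSubgaussianMGF_of_sub_le {α : Type*} [MeasurableSpace α] {μ : Measure α}
    [IsProbabilityMeasure μ] {f : α → ℝ} {c : ℝ≥0} (hf : Measurable f)
    (hd : ∀ x y, f x - f y ≤ c) :
    HasSubgaussianMGF (fun x => f x - μ[f]) ((c / 2) ^ 2) μ := by
  obtain ⟨x₀⟩ := nonempty_of_isProbabilityMeasure μ
  have : Nonempty α := ⟨x₀⟩
  have hbdd : BddBelow (Set.range f) := ⟨f x₀ - c, Set.forall_mem_range.2 fun x => by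
    linarith [hd x₀ x]⟩
  have hIcc (x : α) : f x ∈ Set.Icc (⨅ y, f y) ((⨅ y, f y) + c) :=
    ⟨ciInf_le hbdd x, sub_le_iff_le_add.1 (le_ciInf fun y => sub_le_comm.1 (hd x y))⟩
  simpa using hasSubgaussianMGF_of_mem_Icc (μ := μ) hf.aemeasurable (.of_forall hIcc)

theorem sub_le_sum_of_bounded_differences {n : ℕ} {α : Fin n → Type u} {f : (∀ i, α i) → ℝ}
    {c : Fin n → ℝ} (hd : ∀ S i x, f (Function.update S i x) - f S ≤ c i) (S T : ∀ i, α i) :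
    f S - f T ≤ ∑ i, c i := by
  have key (s : Finset (Fin n)) : f (s.piecewise S T) - f T ≤ ∑ i ∈ s, c i := by
    induction s using Finset.induction_on with
    | empty => simp
    | insert i s hi ih =>
      rw [Finset.piecewise_insert, Finset.sum_insert hi]
      linarith [hd (s.piecewise S T) i (S i)]
  simpa using key univ

theorem integrable_of_bounded_differences {n : ℕ} {α : Fin n → Type u}
    [∀ i, MeasurableSpace (α i)] {μ : Measure (∀ i, α i)} [IsFiniteMeasure μ]
    {f : (∀ i, α i) → ℝ} {c : Fin n → ℝ} (hf : Measurable f)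
    (hd : ∀ S i x, f (Function.update S i x) - f S ≤ c i) : Integrable f μ := by
  rcases isEmpty_or_nonempty (∀ i, α i) with _ | ⟨⟨T⟩⟩
  · simp [Measure.eq_zero_of_isEmpty μ]
  · exact .of_bound hf.aestronglyMeasurable (|f T| + ∑ i, c i) (.of_forall fun S => abs_le.2
      ⟨by linarith [neg_abs_le (f T), sub_le_sum_of_bounded_differences hd T S],
        by linarith [le_abs_self (f T), sub_le_sum_of_bounded_differences hd S T]⟩)

theorem hasSubgaussianMGF_prod_of_sub_le {α β : Type*} [MeasurableSpace α] [MeasurableSpace β]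
    {μ : Measure α} {ν : Measure β} [IsProbabilityMeasure μ] [IsProbabilityMeasure ν]
    {F : α × β → ℝ} {c b : ℝ≥0} (hF : Measurable F) (hint : Integrable F (μ.prod ν))
    (hd : ∀ x x' y, F (x, y) - F (x', y) ≤ c)
    (hsec : ∀ x, HasSubgaussianMGF (fun y => F (x, y) - ∫ y', F (x, y') ∂ν) b ν) :
    HasSubgaussianMGF (fun p => F p - ∫ q, F q ∂μ.prod ν) ((c / 2) ^ 2 + b) (μ.prod ν) := by
  let h (x : α) : ℝ := ∫ y, F (x, y) ∂ν
  have hhm : Measurable h := hF.stronglyMeasurable.integral_prod_right'.measurable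
  have hint_sec (x : α) : Integrable (fun y => F (x, y)) ν :=
    ((hsec x).integrable.add (integrable_const (h x))).congr
      (.of_forall fun y => sub_add_cancel _ _)
  have hh (x x' : α) : h x - h x' ≤ c := by
    simpa [h, integral_sub (hint_sec x) (hint_sec x')] using
      integral_mono ((hint_sec x).sub (hint_sec x')) (integrable_const (c : ℝ)) (hd x x')
  convert! hasSubgaussianMGF_add_prod (hasSubgaussianMGF_of_sub_le (μ := μ) hhm hh)
    (hF.sub (hhm.comp measurable_fst)) hsec using 1
  ext p
  rw [integral_prod _ hint]
  exact (sub_add_sub_cancel' (h p.1) _ _).symm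

/- McDiarmid's inequality. The conditional expectation given the first coordinate has oscillation
at most `c 0`, so Hoeffding's lemma applies to it; the induction hypothesis handles the rest. -/
theorem hasSubgaussianMGF_of_bounded_differences {n : ℕ} {α : Fin n → Type u}
    [∀ i, MeasurableSpace (α i)] (ν : ∀ i, Measure (α i)) [∀ i, IsProbabilityMeasure (ν i)]
    {f : (∀ i, α i) → ℝ} {c : Fin n → ℝ≥0} (hf : Measurable f)
    (hd : ∀ S i x, f (Function.update S i x) - f S ≤ c i) :
    HasSubgaussianMGF (fun S => f S - ∫ T, f T ∂Measure.pi ν) (∑ i, (c i / 2) ^ 2)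
      (Measure.pi ν) := by
  induction n with
  | zero =>
    have hconst : f = fun _ => f default := funext fun S => congrArg f (Subsingleton.elim _ _)
    rw [hconst]
    simp
  | succ n ih =>
    let ν' : (i : Fin n) → Measure (α i.succ) := fun i => ν i.succ
    let e : (∀ i, α i) ≃ᵐ α 0 × ((i : Fin n) → α i.succ) := .piFinSuccAbove α 0
    have he : MeasurePreserving e (.pi ν) ((ν 0).prod (.pi ν')) :=
      measurePreserving_piFinSuccAbove ν 0
    let F : α 0 × (∀ i : Fin n, α i.succ) → ℝ := f ∘ e.symm
    have hF (x y) : F (x, y) = f (Fin.cons x y) := congrArg f (Fin.insertNth_zero x y)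
    have hFe (S) : F (e S) = f S := congrArg f (e.symm_apply_apply S)
    have hFm : Measurable F := hf.comp e.symm.measurable
    have hd_tail (x S) (i : Fin n) (z) : F (x, Function.update S i z) - F (x, S) ≤ c i.succ := by
      simpa only [hF, Fin.cons_update] using hd (Fin.cons x S) i.succ z
    have hd_head (x x' y) : F (x, y) - F (x', y) ≤ c 0 := by
      simpa only [hF, Fin.update_cons_zero] using hd (Fin.cons x' y) 0 x
    have hint : Integrable F ((ν 0).prod (.pi ν')) :=
      (he.symm.integrable_comp_emb e.symm.measurableEmbedding).2
        (integrable_of_bounded_differences hf hd)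
    have hprod := hasSubgaussianMGF_prod_of_sub_le hFm hint hd_head
      fun x => ih ν' (hFm.comp measurable_prodMk_left) (hd_tail x)
    rw [Fin.sum_univ_succ]
    rw [← he.integral_comp', ← he.map_eq] at hprod
    simpa only [Function.comp_def, hFe] using hprod.of_map e.measurable.aemeasurable

end BoundedDifferences

section Signs

variable {n : ℕ}

/-- The law of `n` independent uniform signs, coded by booleans as in `Model.signSampleLaw`. -/
noncomputable def signLaw (n : ℕ) : Measure (Fin n → Bool) :=
  (PMF.uniformOfFintype (Fin n → Bool)).toMeasure

instance : IsProbabilityMeasure (signLaw n) := PMF.toMeasure.isProbabilityMeasure _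

theorem signLaw_singleton (σ : Fin n → Bool) :
    signLaw n {σ} = (Fintype.card (Fin n → Bool) : ℝ≥0∞)⁻¹ := by
  rw [signLaw, PMF.toMeasure_apply_singleton _ _ (.singleton σ), PMF.uniformOfFintype_apply]

theorem measurePreserving_signLaw (e : Equiv.Perm (Fin n → Bool)) :
    MeasurePreserving e (signLaw n) (signLaw n) := by
  refine ⟨measurable_of_finite e, Measure.ext_of_singleton fun σ => ?_⟩
  rw [Measure.map_apply (measurable_of_finite e) (.singleton σ), ← e.image_symm_eq_preimage,
    Set.image_singleton, signLaw_singleton, signLaw_singleton]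

theorem sign_not (b : Bool) : sign (!b) = -sign b := by cases b <;> simp [sign]

theorem abs_sign (b : Bool) : |sign b| = 1 := by cases b <;> simp [sign]

/-- The permutation of the sign vectors which flips the `i`-th sign. -/
def flipAt (i : Fin n) : Equiv.Perm (Fin n → Bool) :=
  Function.Involutive.toPerm (fun σ => Function.update σ i (!σ i)) fun σ => by simp

theorem flipAt_apply (i : Fin n) (σ : Fin n → Bool) :
    flipAt i σ = Function.update σ i (!σ i) := rfl

theorem sum_sign (i : Fin n) (σ : Fin n → Bool) (c : Fin n → ℝ) :
    ∑ j, sign (σ j) * c j = ∑ j ∈ univ.erase i, sign (σ j) * c j + sign (σ i) * c i :=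
  (sum_erase_add _ _ (mem_univ i)).symm

theorem sum_sign_flipAt (i : Fin n) (σ : Fin n → Bool) (c : Fin n → ℝ) :
    ∑ j, sign (flipAt i σ j) * c j
      = ∑ j ∈ univ.erase i, sign (σ j) * c j - sign (σ i) * c i := by
  rw [sum_sign i, sub_eq_add_neg, ← neg_mul, ← sign_not, flipAt_apply, Function.update_self]
  congr 1
  exact sum_congr rfl fun j hj => by rw [Function.update_of_ne (ne_of_mem_erase hj)]

theorem signLaw_sum_sign_eq_zero_le {c : Fin n → ℝ} (hc : c ≠ 0) :
    signLaw n {σ | ∑ j, sign (σ j) * c j = 0} ≤ 2⁻¹ := by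
  obtain ⟨i, hi⟩ := Function.ne_iff.1 hc
  let A := {σ : Fin n → Bool | ∑ j, sign (σ j) * c j = 0}
  have hA (B : Set (Fin n → Bool)) : MeasurableSet B := B.toFinite.measurableSet
  have hdisj : Disjoint A (flipAt i ⁻¹' A) := by
    refine Set.disjoint_left.2 fun σ (h₁ : _ = _) (h₂ : _ = _) => hi ?_
    rw [sum_sign i] at h₁
    rw [sum_sign_flipAt] at h₂
    have : sign (σ i) * c i = 0 := by linarith
    exact (mul_eq_zero.1 this).resolve_left fun h => by simpa [h] using abs_sign (σ i)
  have htwo : 2 * signLaw n A ≤ 1 := by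
    calc 2 * signLaw n A = signLaw n A + signLaw n (flipAt i ⁻¹' A) := by
          rw [(measurePreserving_signLaw _).measure_preimage (hA A).nullMeasurableSet, two_mul]
      _ = signLaw n (A ∪ flipAt i ⁻¹' A) := (measure_union hdisj (hA _)).symm
      _ ≤ 1 := prob_le_one
  exact ENNReal.le_inv_iff_mul_le.2 (by rwa [mul_comm])

end Signs

section Contraction

variable {ι : Type*} {n : ℕ}

theorem iSup_ofReal_add_iSup_ofReal_le {g p q : ι → ℝ} (h₀ : ∀ s, |p s| ≤ |q s|)
    (h : ∀ s t, |p s - p t| ≤ |q s - q t|) :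
    (⨆ s, ENNReal.ofReal (g s + p s)) + ⨆ s, ENNReal.ofReal (g s - p s)
      ≤ (⨆ s, ENNReal.ofReal (g s + q s)) + ⨆ s, ENNReal.ofReal (g s - q s) := by
  rcases isEmpty_or_nonempty ι with _ | _
  · simp
  set U := ⨆ s, ENNReal.ofReal (g s + q s)
  set L := ⨆ s, ENNReal.ofReal (g s - q s)
  have hU s : ENNReal.ofReal (g s + q s) ≤ U := le_iSup (fun s => ENNReal.ofReal (g s + q s)) s
  have hL s : ENNReal.ofReal (g s - q s) ≤ L := le_iSup (fun s => ENNReal.ofReal (g s - q s)) s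
  have hone {s : ι} {x : ℝ} (hx : x ≤ g s + |p s|) : ENNReal.ofReal x ≤ U + L := by
    rcases abs_cases (q s) with ⟨hq, -⟩ | ⟨hq, -⟩
    · exact (ENNReal.ofReal_le_ofReal (by linarith [h₀ s])).trans ((hU s).trans le_self_add)
    · exact (ENNReal.ofReal_le_ofReal (by linarith [h₀ s])).trans ((hL s).trans le_add_self)
  have htwo {s t : ι} {x : ℝ} (hx : x ≤ g s + q s + (g t - q t)) : ENNReal.ofReal x ≤ U + L :=
    (ENNReal.ofReal_le_ofReal hx).trans
      (ENNReal.ofReal_add_le.trans (add_le_add (hU s) (hL t)))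
  refine ENNReal.iSup_add_iSup_le fun s t => ?_
  rcases le_total (g s + p s) 0 with hs | hs
  · rw [ENNReal.ofReal_of_nonpos hs, zero_add]
    exact hone (s := t) (by linarith [neg_abs_le (p t)])
  rcases le_total (g t - p t) 0 with ht | ht
  · rw [ENNReal.ofReal_of_nonpos ht, add_zero]
    exact hone (s := s) (by linarith [le_abs_self (p s)])
  rw [← ENNReal.ofReal_add hs ht]
  have hst := (le_abs_self _).trans (h s t)
  rcases abs_cases (q s - q t) with ⟨hq, -⟩ | ⟨hq, -⟩
  · exact htwo (s := s) (t := t) (by linarith)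
  · exact htwo (s := t) (t := s) (by linarith)

theorem lintegral_iSup_sign_le_of_eq_off {p q : ι → Fin n → ℝ} (i : Fin n)
    (hoff : ∀ s, ∀ j ≠ i, p s j = q s j) (h₀ : ∀ s, |p s i| ≤ |q s i|)
    (h : ∀ s t, |p s i - p t i| ≤ |q s i - q t i|) :
    ∫⁻ σ, ⨆ s, ENNReal.ofReal (∑ j, sign (σ j) * p s j) ∂signLaw n
      ≤ ∫⁻ σ, ⨆ s, ENNReal.ofReal (∑ j, sign (σ j) * q s j) ∂signLaw n := by
  have hpair (F : (Fin n → Bool) → ℝ≥0∞) :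
      2 * ∫⁻ σ, F σ ∂signLaw n = ∫⁻ σ, (F σ + F (flipAt i σ)) ∂signLaw n := by
    rw [lintegral_add_left (measurable_of_finite F),
      (measurePreserving_signLaw (flipAt i)).lintegral_comp (measurable_of_finite F), two_mul]
  have hrest s (σ : Fin n → Bool) : ∑ j ∈ univ.erase i, sign (σ j) * p s j
      = ∑ j ∈ univ.erase i, sign (σ j) * q s j :=
    sum_congr rfl fun j hj => by rw [hoff s j (ne_of_mem_erase hj)]
  refine (ENNReal.mul_le_mul_iff_right two_ne_zero ENNReal.ofNat_ne_top).1 ?_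
  rw [hpair, hpair]
  refine lintegral_mono fun σ => ?_
  simp only [sum_sign_flipAt]
  simp only [sum_sign i, hrest]
  refine iSup_ofReal_add_iSup_ofReal_le (fun s => ?_) fun s t => ?_
  · simpa only [abs_mul, abs_sign, one_mul] using h₀ s
  · simpa only [← mul_sub, abs_mul, abs_sign, one_mul] using h s t

theorem lintegral_iSup_sign_le {p q : ι → Fin n → ℝ} (h₀ : ∀ j s, |p s j| ≤ |q s j|)
    (h : ∀ j s t, |p s j - p t j| ≤ |q s j - q t j|) :
    ∫⁻ σ, ⨆ s, ENNReal.ofReal (∑ j, sign (σ j) * p s j) ∂signLaw n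
      ≤ ∫⁻ σ, ⨆ s, ENNReal.ofReal (∑ j, sign (σ j) * q s j) ∂signLaw n := by
  have key (J : Finset (Fin n)) :
      ∫⁻ σ, ⨆ s, ENNReal.ofReal (∑ j, sign (σ j) * p s j) ∂signLaw n
        ≤ ∫⁻ σ, ⨆ s, ENNReal.ofReal (∑ j, sign (σ j) * J.piecewise (q s) (p s) j) ∂signLaw n := by
    induction J using Finset.induction_on with
    | empty => simp
    | insert i J hi ih =>
      refine ih.trans (lintegral_iSup_sign_le_of_eq_off i (fun s j hj => ?_) ?_ ?_)
      · rw [piecewise_insert, Function.update_of_ne hj]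
      · simpa [hi] using h₀ i
      · simpa [hi] using h i
  simpa using key univ

end Contraction

section Symmetrization

variable {ι α : Type*} [MeasurableSpace α] {ν : Measure α} {n : ℕ} {h : ι → α → ℝ}

/-- Measurability of the suprema of the affine images of the empirical process of the family `h`
under `ν`. -/
def MeasurableSups (ν : Measure α) (h : ι → α → ℝ) : Prop :=
  ∀ (m : ℕ) (a : Fin m → ℝ) (c : ℝ), Measurable fun S : Fin m → α =>
    ⨆ s, ENNReal.ofReal (c * ∫ x, h s x ∂ν + ∑ i, a i * h s (S i))

theorem MeasurableSups.sum (hsup : MeasurableSups ν h) (a : Fin n → ℝ) :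
    Measurable fun S : Fin n → α => ⨆ s, ENNReal.ofReal (∑ i, a i * h s (S i)) := by
  simpa using hsup n a 0

theorem MeasurableSups.sum_integral_sub (hsup : MeasurableSups ν h) :
    Measurable fun S : Fin n → α =>
      ⨆ s, ENNReal.ofReal (∑ i, (∫ x, h s x ∂ν - h s (S i))) := by
  simpa [sum_add_distrib, sub_eq_add_neg] using hsup n (fun _ => -1) n

theorem MeasurableSups.sum_sub_prod (hsup : MeasurableSups ν h) :
    Measurable fun p : (Fin n → α) × (Fin n → α) =>
      ⨆ s, ENNReal.ofReal (∑ i, (h s (p.2 i) - h s (p.1 i))) := by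
  have happend : Measurable fun p : (Fin n → α) × (Fin n → α) => Fin.append p.2 p.1 :=
    measurable_pi_lambda _ fun i => by
      refine Fin.addCases (fun j => ?_) (fun j => ?_) i
      · simp only [Fin.append_left]
        fun_prop
      · simp only [Fin.append_right]
        fun_prop
  simpa only [Function.comp_def, Fin.sum_univ_add, Fin.append_left, Fin.append_right, one_mul,
    neg_one_mul, ← sum_add_distrib, ← sub_eq_add_neg] using
    (hsup.sum (Fin.append (fun _ : Fin n => 1) fun _ : Fin n => -1)).comp happend

theorem ofReal_integral_le_lintegral (f : α → ℝ) :
    ENNReal.ofReal (∫ x, f x ∂ν) ≤ ∫⁻ x, ENNReal.ofReal (f x) ∂ν := by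
  by_cases hf : Integrable f ν
  · refine ENNReal.ofReal_le_of_le_toReal ?_
    rw [integral_eq_lintegral_pos_part_sub_lintegral_neg_part hf]
    exact sub_le_self _ ENNReal.toReal_nonneg
  · simp [integral_undef hf]

variable [IsProbabilityMeasure ν]

theorem lintegral_iSup_integral_sub_le_prod (hint : ∀ s, Integrable (h s) ν)
    (hsup : MeasurableSups ν h) :
    ∫⁻ S, ⨆ s, ENNReal.ofReal (∑ i, (∫ x, h s x ∂ν - h s (S i))) ∂Measure.pi (fun _ : Fin n => ν)
      ≤ ∫⁻ z, ⨆ s, ENNReal.ofReal (∑ i, (h s (z i).2 - h s (z i).1))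
          ∂Measure.pi (fun _ : Fin n => ν.prod ν) := by
  have hmean s (S : Fin n → α) : ∑ i, (∫ x, h s x ∂ν - h s (S i))
      = ∫ T : Fin n → α, ∑ i, (h s (T i) - h s (S i)) ∂Measure.pi fun _ => ν := by
    have hT i : Integrable (fun T : Fin n → α => h s (T i)) (Measure.pi fun _ => ν) :=
      integrable_comp_eval (hint s)
    have hTS i : Integrable (fun T : Fin n → α => h s (T i) - h s (S i)) (Measure.pi fun _ => ν) :=
      (hT i).sub (integrable_const _)
    rw [integral_finsetSum univ fun i _ => hTS i]
    refine sum_congr rfl fun i _ => ?_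
    rw [integral_sub (hT i) (integrable_const _),
      integral_comp_eval (hint s).aestronglyMeasurable]
    simp
  have hprod := measurePreserving_arrowProdEquivProdArrow α α (Fin n) (fun _ => ν) (fun _ => ν)
  calc ∫⁻ S, ⨆ s, ENNReal.ofReal (∑ i, (∫ x, h s x ∂ν - h s (S i))) ∂Measure.pi (fun _ : Fin n => ν)
      ≤ ∫⁻ S, ∫⁻ T, ⨆ s, ENNReal.ofReal (∑ i, (h s (T i) - h s (S i)))
          ∂Measure.pi (fun _ : Fin n => ν) ∂Measure.pi (fun _ : Fin n => ν) := by
        refine lintegral_mono fun S => iSup_le fun s => ?_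
        rw [hmean]
        exact (ofReal_integral_le_lintegral _).trans (lintegral_mono fun T =>
          le_iSup (fun s => ENNReal.ofReal (∑ i, (h s (T i) - h s (S i)))) s)
    _ = ∫⁻ p, ⨆ s, ENNReal.ofReal (∑ i, (h s (p.2 i) - h s (p.1 i)))
          ∂(Measure.pi fun _ : Fin n => ν).prod (Measure.pi fun _ : Fin n => ν) :=
        (lintegral_prod _ hsup.sum_sub_prod.aemeasurable).symm
    _ = _ := (hprod.lintegral_comp hsup.sum_sub_prod).symm

theorem lintegral_iSup_sub_le (hsup : MeasurableSups ν h) (σ : Fin n → Bool) :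
    ∫⁻ z, ⨆ s, ENNReal.ofReal (∑ i, (h s (z i).2 - h s (z i).1))
        ∂Measure.pi (fun _ : Fin n => ν.prod ν)
      ≤ ∫⁻ S, ⨆ s, ENNReal.ofReal (∑ i, sign (σ i) * h s (S i)) ∂Measure.pi (fun _ : Fin n => ν)
        + ∫⁻ S, ⨆ s, ENNReal.ofReal (∑ i, sign (!σ i) * h s (S i))
            ∂Measure.pi (fun _ : Fin n => ν) := by
  let e (b : Bool) : α × α → α × α := if b then id else Prod.swap
  have he (b : Bool) : MeasurePreserving (e b) (ν.prod ν) (ν.prod ν) := by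
    cases b
    · exact Measure.measurePreserving_swap
    · exact .id _
  have hsub b (z : α × α) s : h s (e b z).2 - h s (e b z).1
      = sign b * h s z.2 + sign (!b) * h s z.1 := by
    cases b <;> simp [e, sign] <;> ring
  have hfst : MeasurePreserving (fun z : Fin n → α × α => fun i => (z i).1)
      (Measure.pi fun _ => ν.prod ν) (Measure.pi fun _ => ν) :=
    measurePreserving_pi _ _ fun _ => measurePreserving_fst
  have hsnd : MeasurePreserving (fun z : Fin n → α × α => fun i => (z i).2)
      (Measure.pi fun _ => ν.prod ν) (Measure.pi fun _ => ν) :=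
    measurePreserving_pi _ _ fun _ => measurePreserving_snd
  have hswap := measurePreserving_pi (fun _ : Fin n => ν.prod ν) (fun _ => ν.prod ν)
    fun i => he (σ i)
  have hW : Measurable fun z : Fin n → α × α =>
      ⨆ s, ENNReal.ofReal (∑ i, (h s (z i).2 - h s (z i).1)) :=
    hsup.sum_sub_prod.comp (f := fun z : Fin n → α × α => (fun i => (z i).1, fun i => (z i).2))
      (by fun_prop)
  rw [← hswap.lintegral_comp hW, ← hsnd.lintegral_comp (hsup.sum _),
    ← hfst.lintegral_comp (hsup.sum fun i => sign (!σ i))]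
  refine le_of_le_of_eq (lintegral_mono fun z => iSup_le fun s => ?_)
    (lintegral_add_left ((hsup.sum fun i => sign (σ i)).comp hsnd.measurable) _)
  simp only [hsub, sum_add_distrib]
  exact ENNReal.ofReal_add_le.trans (add_le_add
    (le_iSup (fun s => ENNReal.ofReal (∑ i, sign (σ i) * h s (z i).2)) s)
    (le_iSup (fun s => ENNReal.ofReal (∑ i, sign (!σ i) * h s (z i).1)) s))

theorem lintegral_iSup_integral_sub_le_two_mul (hint : ∀ s, Integrable (h s) ν)
    (hsup : MeasurableSups ν h) :
    ∫⁻ S, ⨆ s, ENNReal.ofReal (∑ i, (∫ x, h s x ∂ν - h s (S i))) ∂Measure.pi (fun _ : Fin n => ν)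
      ≤ 2 * ∫⁻ p, ⨆ s, ENNReal.ofReal (∑ i, sign (p.1 i) * h s (p.2 i))
          ∂(signLaw n).prod (Measure.pi fun _ : Fin n => ν) := by
  let R (σ : Fin n → Bool) : ℝ≥0∞ :=
    ∫⁻ S, ⨆ s, ENNReal.ofReal (∑ i, sign (σ i) * h s (S i)) ∂Measure.pi (fun _ : Fin n => ν)
  let neg : Equiv.Perm (Fin n → Bool) :=
    Function.Involutive.toPerm (fun σ i => !σ i) fun σ => by simp
  have hneg : ∫⁻ σ, R (neg σ) ∂signLaw n = ∫⁻ σ, R σ ∂signLaw n :=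
    (measurePreserving_signLaw neg).lintegral_comp (measurable_of_finite R)
  have hmeas : Measurable fun p : (Fin n → Bool) × (Fin n → α) =>
      ⨆ s, ENNReal.ofReal (∑ i, sign (p.1 i) * h s (p.2 i)) :=
    measurable_from_prod_countable_right fun σ => hsup.sum fun i => sign (σ i)
  calc ∫⁻ S, ⨆ s, ENNReal.ofReal (∑ i, (∫ x, h s x ∂ν - h s (S i))) ∂Measure.pi (fun _ : Fin n => ν)
      = ∫⁻ _, ∫⁻ S, ⨆ s, ENNReal.ofReal (∑ i, (∫ x, h s x ∂ν - h s (S i)))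
          ∂Measure.pi (fun _ : Fin n => ν) ∂signLaw n := by simp
    _ ≤ ∫⁻ σ, (R σ + R (neg σ)) ∂signLaw n := lintegral_mono fun σ =>
        (lintegral_iSup_integral_sub_le_prod hint hsup).trans (lintegral_iSup_sub_le hsup σ)
    _ = 2 * ∫⁻ σ, R σ ∂signLaw n := by
        rw [lintegral_add_left (measurable_of_finite R), hneg, two_mul]
    _ = _ := by
        rw [lintegral_prod _ hmeas.aemeasurable]

end Symmetrization

section Concentration

variable {ι α : Type*} [MeasurableSpace α] {ν : Measure α} {n : ℕ} {h : ι → α → ℝ} {c : ℝ≥0}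

theorem iSup_sum_integral_sub_le [IsProbabilityMeasure ν] (h₀ : ∀ s x, 0 ≤ h s x)
    (h₁ : ∀ s x, h s x ≤ c) (S : Fin n → α) :
    ⨆ s, ENNReal.ofReal (∑ i, (∫ x, h s x ∂ν - h s (S i))) ≤ ENNReal.ofReal (n * c) := by
  refine iSup_le fun s => ENNReal.ofReal_le_ofReal ?_
  have hmean : ∫ x, h s x ∂ν ≤ c := by
    simpa using integral_mono_of_nonneg (μ := ν) (.of_forall (h₀ s)) (integrable_const (c : ℝ))
      (.of_forall (h₁ s))
  calc ∑ i, (∫ x, h s x ∂ν - h s (S i)) ≤ ∑ _i : Fin n, (c : ℝ) :=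
        sum_le_sum fun i _ => by linarith [h₀ s (S i)]
    _ = n * c := by simp

theorem iSup_sum_integral_sub_update_le (h₀ : ∀ s x, 0 ≤ h s x) (h₁ : ∀ s x, h s x ≤ c)
    (S : Fin n → α) (i : Fin n) (x : α) :
    ⨆ s, ENNReal.ofReal (∑ j, (∫ y, h s y ∂ν - h s (Function.update S i x j)))
      ≤ (⨆ s, ENNReal.ofReal (∑ j, (∫ y, h s y ∂ν - h s (S j)))) + c := by
  refine iSup_le fun s => ?_
  have hupdate : ∑ j, (∫ y, h s y ∂ν - h s (Function.update S i x j))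
      ≤ ∑ j, (∫ y, h s y ∂ν - h s (S j)) + c := by
    have hrest : ∑ j ∈ univ.erase i, (∫ y, h s y ∂ν - h s (Function.update S i x j))
        = ∑ j ∈ univ.erase i, (∫ y, h s y ∂ν - h s (S j)) :=
      sum_congr rfl fun j hj => by rw [Function.update_of_ne (ne_of_mem_erase hj)]
    rw [← sum_erase_add _ _ (mem_univ i), ← sum_erase_add univ (fun j => _ - h s (S j))
      (mem_univ i), hrest, Function.update_self]
    linarith [h₀ s x, h₁ s (S i)]
  refine (ENNReal.ofReal_le_ofReal hupdate).trans (ENNReal.ofReal_add_le.trans ?_)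
  rw [ENNReal.ofReal_coe_nnreal]
  gcongr
  exact le_iSup (fun s => ENNReal.ofReal (∑ j, (∫ y, h s y ∂ν - h s (S j)))) s

theorem measureReal_le_iSup_sum_integral_sub_le [IsProbabilityMeasure ν] (h₀ : ∀ s x, 0 ≤ h s x)
    (h₁ : ∀ s x, h s x ≤ c) (hsup : MeasurableSups ν h) {b t : ℝ} (hb : 0 ≤ b) (ht : 0 ≤ t)
    (hmean : ∫⁻ S, ⨆ s, ENNReal.ofReal (∑ i, (∫ x, h s x ∂ν - h s (S i)))
      ∂Measure.pi (fun _ : Fin n => ν) ≤ ENNReal.ofReal b) :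
    (Measure.pi fun _ : Fin n => ν).real
        {S | b + t ≤ (⨆ s, ENNReal.ofReal (∑ i, (∫ x, h s x ∂ν - h s (S i)))).toReal}
      ≤ Real.exp (-(2 * t ^ 2 / (n * c ^ 2))) := by
  set D : (Fin n → α) → ℝ≥0∞ := fun S => ⨆ s, ENNReal.ofReal (∑ i, (∫ x, h s x ∂ν - h s (S i)))
  have hD : Measurable D := hsup.sum_integral_sub
  have hfin S : D S ≠ ∞ := ne_top_of_le_ne_top ENNReal.ofReal_ne_top
    (iSup_sum_integral_sub_le h₀ h₁ S)
  have hdiff S i x : (D (Function.update S i x)).toReal - (D S).toReal ≤ c := by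
    have := ENNReal.toReal_mono (ENNReal.add_ne_top.2 ⟨hfin S, ENNReal.coe_ne_top⟩)
      (iSup_sum_integral_sub_update_le (ν := ν) h₀ h₁ S i x)
    rw [ENNReal.toReal_add (hfin S) ENNReal.coe_ne_top, ENNReal.coe_toReal] at this
    linarith
  have hmean' : ∫ S, (D S).toReal ∂Measure.pi (fun _ : Fin n => ν) ≤ b := by
    rw [integral_toReal hD.aemeasurable (.of_forall fun S => (hfin S).lt_top)]
    exact ENNReal.toReal_le_of_le_ofReal hb hmean
  have hsub := hasSubgaussianMGF_of_bounded_differences (fun _ : Fin n => ν) (c := fun _ => c)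
    hD.ennreal_toReal hdiff
  calc (Measure.pi fun _ : Fin n => ν).real {S | b + t ≤ (D S).toReal}
      ≤ (Measure.pi fun _ : Fin n => ν).real
          {S | t ≤ (D S).toReal - ∫ T, (D T).toReal ∂Measure.pi (fun _ : Fin n => ν)} :=
        measureReal_mono fun S (hS : b + t ≤ (D S).toReal) =>
          le_sub_iff_add_le'.2 ((add_le_add_left hmean' t).trans hS)
    _ ≤ Real.exp (-t ^ 2 / (2 * (∑ _i : Fin n, (c / 2) ^ 2 : ℝ≥0))) := hsub.measure_ge_le ht
    _ = Real.exp (-(2 * t ^ 2 / (n * c ^ 2))) := by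
        rcases n.eq_zero_or_pos with rfl | hn
        · simp
        rcases eq_or_ne c 0 with rfl | hc
        · simp
        · congr 1
          have : (c : ℝ) ≠ 0 := NNReal.coe_ne_zero.2 hc
          simp only [sum_const, card_univ, Fintype.card_fin, nsmul_eq_mul, NNReal.coe_mul,
            NNReal.coe_natCast, NNReal.coe_pow, NNReal.coe_div, NNReal.coe_ofNat]
          field_simp

end Concentration

section SmallBall

/-- The square of `t`, truncated at the level `a ^ 2`. -/
def truncSq (a t : ℝ) : ℝ := min a |t| ^ 2

theorem truncSq_nonneg (a t : ℝ) : 0 ≤ truncSq a t := sq_nonneg _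

theorem continuous_truncSq (a : ℝ) : Continuous (truncSq a) :=
  (continuous_const.min continuous_abs).pow 2

theorem truncSq_of_le_abs {a t : ℝ} (h : a ≤ |t|) : truncSq a t = a ^ 2 := by
  rw [truncSq, min_eq_left h]

variable {a : ℝ}

theorem truncSq_le_sq (ha : 0 ≤ a) (t : ℝ) : truncSq a t ≤ t ^ 2 := by
  rw [← sq_abs t]
  exact pow_le_pow_left₀ (le_min ha (abs_nonneg t)) (min_le_right _ _) 2

theorem truncSq_le (ha : 0 ≤ a) (t : ℝ) : truncSq a t ≤ a ^ 2 :=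
  pow_le_pow_left₀ (le_min ha (abs_nonneg t)) (min_le_left _ _) 2

theorem abs_truncSq_sub_le (ha : 0 ≤ a) (s t : ℝ) :
    |truncSq a s - truncSq a t| ≤ |2 * a * s - 2 * a * t| := by
  have hadd : |min a (|s|) + min a (|t|)| ≤ 2 * a := by
    rw [abs_of_nonneg (add_nonneg (le_min ha (abs_nonneg s)) (le_min ha (abs_nonneg t)))]
    linarith [min_le_left a (|s|), min_le_left a (|t|)]
  have hsub : |min a (|s|) - min a (|t|)| ≤ |s - t| := by
    refine (abs_min_sub_min_le_max a (|s|) a (|t|)).trans (max_le (by simp) ?_)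
    exact abs_abs_sub_abs_le s t
  rw [truncSq, truncSq, sq_sub_sq, abs_mul, ← mul_sub, abs_mul (2 * a),
    abs_of_nonneg (show 0 ≤ 2 * a by positivity)]
  exact mul_le_mul hadd hsub (abs_nonneg _) (by positivity)

theorem abs_truncSq_le (ha : 0 ≤ a) (t : ℝ) : |truncSq a t| ≤ |2 * a * t| := by
  simpa [truncSq, ha] using abs_truncSq_sub_le ha t 0

variable {ι α : Type*} [MeasurableSpace α] {ν : Measure α} [IsProbabilityMeasure ν] {n : ℕ}
  {u : ι → α → ℝ}

theorem integrable_truncSq (ha : 0 ≤ a) {f : α → ℝ} (hf : Measurable f) :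
    Integrable (fun x => truncSq a (f x)) ν :=
  .of_bound ((continuous_truncSq a).measurable.comp hf).aestronglyMeasurable (a ^ 2)
    (.of_forall fun x => by
      rw [Real.norm_of_nonneg (truncSq_nonneg _ _)]
      exact truncSq_le ha _)

theorem lintegral_iSup_integral_truncSq_sub_le (ha : 0 ≤ a) (hu : ∀ s, Measurable (u s))
    (husup : MeasurableSups ν u) (hsup : MeasurableSups ν fun s x => truncSq a (u s x)) :
    ∫⁻ S, ⨆ s, ENNReal.ofReal (∑ i, (∫ x, truncSq a (u s x) ∂ν - truncSq a (u s (S i))))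
        ∂Measure.pi (fun _ : Fin n => ν)
      ≤ ENNReal.ofReal (4 * a) * ∫⁻ p, ⨆ s, ENNReal.ofReal (∑ i, sign (p.1 i) * u s (p.2 i))
          ∂(signLaw n).prod (Measure.pi fun _ : Fin n => ν) := by
  have hprod {h : ι → α → ℝ} (hh : MeasurableSups ν h) :
      ∫⁻ p, ⨆ s, ENNReal.ofReal (∑ i, sign (p.1 i) * h s (p.2 i))
          ∂(signLaw n).prod (Measure.pi fun _ : Fin n => ν)
        = ∫⁻ S, ∫⁻ σ, ⨆ s, ENNReal.ofReal (∑ i, sign (σ i) * h s (S i)) ∂signLaw n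
          ∂Measure.pi (fun _ : Fin n => ν) :=
    have hmeas : Measurable fun p : (Fin n → Bool) × (Fin n → α) =>
        ⨆ s, ENNReal.ofReal (∑ i, sign (p.1 i) * h s (p.2 i)) :=
      measurable_from_prod_countable_right fun σ => hh.sum fun i => sign (σ i)
    lintegral_prod_symm _ hmeas.aemeasurable
  have hcontr (S : Fin n → α) :
      ∫⁻ σ, ⨆ s, ENNReal.ofReal (∑ i, sign (σ i) * truncSq a (u s (S i))) ∂signLaw n
        ≤ ENNReal.ofReal (2 * a)
          * ∫⁻ σ, ⨆ s, ENNReal.ofReal (∑ i, sign (σ i) * u s (S i)) ∂signLaw n := by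
    have := lintegral_iSup_sign_le (p := fun s i => truncSq a (u s (S i)))
      (q := fun s i => 2 * a * u s (S i)) (fun i s => abs_truncSq_le ha _)
      fun i s t => abs_truncSq_sub_le ha _ _
    simp only [mul_left_comm _ (2 * a), ← mul_sum] at this
    simpa only [ENNReal.ofReal_mul (show 0 ≤ 2 * a by positivity), ← ENNReal.mul_iSup,
      lintegral_const_mul' _ _ ENNReal.ofReal_ne_top] using this
  refine (lintegral_iSup_integral_sub_le_two_mul
    (fun s => integrable_truncSq ha (hu s)) hsup).trans ?_
  rw [hprod hsup, hprod husup, show 4 * a = 2 * (2 * a) by ring, ENNReal.ofReal_mul zero_le_two,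
    ENNReal.ofReal_ofNat, mul_assoc, ← lintegral_const_mul' _ _ ENNReal.ofReal_ne_top]
  gcongr with S
  exact hcontr S

theorem mul_le_integral_truncSq (ha : 0 ≤ a) {f : α → ℝ} (hf : Measurable f) {ε : ℝ}
    (h : ENNReal.ofReal ε ≤ ν {x | a ≤ |f x|}) : a ^ 2 * ε ≤ ∫ x, truncSq a (f x) ∂ν :=
  calc a ^ 2 * ε ≤ a ^ 2 * ν.real {x | a ^ 2 ≤ truncSq a (f x)} := by
        gcongr
        exact ((ENNReal.ofReal_le_iff_le_toReal (measure_ne_top _ _)).1 h).trans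
          (measureReal_mono fun x hx => (truncSq_of_le_abs hx).ge)
    _ ≤ ∫ x, truncSq a (f x) ∂ν :=
        mul_meas_ge_le_integral_of_nonneg (.of_forall fun x => truncSq_nonneg _ _)
          (integrable_truncSq ha hf) _

theorem mul_le_sum_sq_of_iSup_lt (ha : 0 ≤ a) (hu : ∀ s, Measurable (u s)) {ε : ℝ}
    {S : Fin n → α}
    (hS : (⨆ s, ENNReal.ofReal (∑ i, (∫ x, truncSq a (u s x) ∂ν - truncSq a (u s (S i))))).toReal
      < n * a ^ 2 * ε / 4 + n * a ^ 2 * ε / 2)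
    {s : ι} (hs : ENNReal.ofReal ε ≤ ν {x | a ≤ |u s x|}) :
    a ^ 2 * ε / 4 ≤ (n : ℝ)⁻¹ * ∑ i, u s (S i) ^ 2 := by
  have hn : 0 < (n : ℝ) := by
    refine Nat.cast_pos.2 (Nat.pos_of_ne_zero fun h => ?_)
    subst h
    exact absurd hS (by simp)
  have hfin := iSup_sum_integral_sub_le (ν := ν) (c := ⟨a ^ 2, sq_nonneg a⟩)
    (fun s x => truncSq_nonneg a (u s x)) (fun s x => truncSq_le ha (u s x)) S
  have hdev := ENNReal.ofReal_le_iff_le_toReal (ne_top_of_le_ne_top ENNReal.ofReal_ne_top hfin) |>.1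
    (le_iSup (fun s => ENNReal.ofReal (∑ i, (∫ x, truncSq a (u s x) ∂ν
      - truncSq a (u s (S i))))) s)
  rw [sum_sub_distrib, sum_const, card_univ, Fintype.card_fin, nsmul_eq_mul] at hdev
  have hlow := mul_le_mul_of_nonneg_left (mul_le_integral_truncSq ha (hu s) hs) hn.le
  have htrunc : ∑ i, truncSq a (u s (S i)) ≤ ∑ i, u s (S i) ^ 2 :=
    sum_le_sum fun i _ => truncSq_le_sq ha _
  rw [inv_mul_eq_div, le_div_iff₀ hn]
  linarith

theorem exists_event_small_ball (ha : 0 < a) {ε : ℝ} (hε : 0 ≤ ε) (hu : ∀ s, Measurable (u s))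
    (husup : MeasurableSups ν u) (hsup : MeasurableSups ν fun s x => truncSq a (u s x))
    (hrad : ∫⁻ p, ⨆ s, ENNReal.ofReal (∑ i, sign (p.1 i) * u s (p.2 i))
      ∂(signLaw n).prod (Measure.pi fun _ : Fin n => ν) ≤ ENNReal.ofReal (n * (a * ε / 16))) :
    ∃ A : Set (Fin n → α), MeasurableSet A ∧
      1 - Real.exp (-(n * ε ^ 2 / 2)) ≤ (Measure.pi fun _ : Fin n => ν).real A ∧
      ∀ S ∈ A, ∀ s, ENNReal.ofReal ε ≤ ν {x | a ≤ |u s x|} →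
        a ^ 2 * ε / 4 ≤ (n : ℝ)⁻¹ * ∑ i, u s (S i) ^ 2 := by
  let D (S : Fin n → α) : ℝ≥0∞ :=
    ⨆ s, ENNReal.ofReal (∑ i, (∫ x, truncSq a (u s x) ∂ν - truncSq a (u s (S i))))
  let c : ℝ≥0 := ⟨a ^ 2, sq_nonneg a⟩
  let B : Set (Fin n → α) := {S | n * a ^ 2 * ε / 4 + n * a ^ 2 * ε / 2 ≤ (D S).toReal}
  have hmean : ∫⁻ S, D S ∂Measure.pi (fun _ : Fin n => ν) ≤ ENNReal.ofReal (n * a ^ 2 * ε / 4) := by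
    refine (lintegral_iSup_integral_truncSq_sub_le ha.le hu husup hsup).trans
      ((mul_le_mul_right hrad _).trans_eq ?_)
    rw [← ENNReal.ofReal_mul (by positivity)]
    ring_nf
  have hB : MeasurableSet B :=
    measurableSet_le measurable_const hsup.sum_integral_sub.ennreal_toReal
  have hprob : (Measure.pi fun _ : Fin n => ν).real B ≤ Real.exp (-(n * ε ^ 2 / 2)) := by
    refine (measureReal_le_iSup_sum_integral_sub_le (c := c) (fun s x => truncSq_nonneg _ _)
      (fun s x => truncSq_le ha.le _) hsup (by positivity) (by positivity) hmean).trans_eq ?_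
    rcases n.eq_zero_or_pos with rfl | hn
    · simp
    · congr 2
      change 2 * (n * a ^ 2 * ε / 2) ^ 2 / (n * (a ^ 2) ^ 2) = _
      field_simp
  refine ⟨Bᶜ, hB.compl, ?_, fun S hS s hs =>
    mul_le_sum_sq_of_iSup_lt ha.le hu (not_le.1 hS) hs⟩
  rw [probReal_compl_eq_one_sub hB]
  linarith

end SmallBall

namespace Model

variable {𝓧 : Type*} [MeasurableSpace 𝓧] {M : Model 𝓧} {H : Set M.V} {fstar f : M.V} {t : ℝ}

section Lift

theorem measurePreserving_fst_law : MeasurePreserving Prod.fst M.law M.μ :=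
  ⟨measurable_fst, rfl⟩

/-- The embedding of `L²(μ)` into the `L²` space of the joint law, `a ↦ a(X)`. -/
noncomputable def liftL2 : Lp ℝ 2 M.μ →ₗᵢ[ℝ] Lp ℝ 2 M.law :=
  Lp.compMeasurePreservingₗᵢ ℝ Prod.fst measurePreserving_fst_law

theorem liftL2_toL2_sub_coe (f h : M.V) :
    liftL2 (M.toL2 f - M.toL2 h) =ᵐ[M.law] fun z => (f : 𝓧 → ℝ) z.1 - (h : 𝓧 → ℝ) z.1 :=
  (Lp.coeFn_compMeasurePreserving _ measurePreserving_fst_law).trans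
    (measurePreserving_fst_law.quasiMeasurePreserving.ae_eq_comp
      (M.memLp_of_mem _ (f - h).2).coeFn_toLp)

/-- The response `Y` as an element of the `L²` space of the joint law. -/
noncomputable def responseL2 (M : Model 𝓧) : Lp ℝ 2 M.law := M.memLp_response.toLp _

theorem measurable_noise (fstar : M.V) : Measurable (M.noise fstar) :=
  ((M.measurable_of_mem _ fstar.2).comp measurable_fst).sub measurable_snd

theorem liftL2_sub_responseL2_coe (fstar : M.V) :
    (liftL2 (M.toL2 fstar) - M.responseL2 : Lp ℝ 2 M.law) =ᵐ[M.law] M.noise fstar := by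
  filter_upwards [Lp.coeFn_sub (liftL2 (M.toL2 fstar)) M.responseL2, M.memLp_response.coeFn_toLp,
    Lp.coeFn_compMeasurePreserving (M.toL2 fstar) measurePreserving_fst_law,
    measurePreserving_fst_law.quasiMeasurePreserving.ae_eq_comp
      (M.memLp_of_mem _ fstar.2).coeFn_toLp] with z hsub hY hlift hf
  rw [hsub, Pi.sub_apply]
  exact congrArg₂ (· - ·) (hlift.trans hf) hY

theorem risk_eq_norm_sq (a : Lp ℝ 2 M.μ) : M.risk a = ‖liftL2 a - M.responseL2‖ ^ 2 := by
  rw [← real_inner_self_eq_norm_sq, L2.inner_def, risk]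
  refine integral_congr_ae ?_
  filter_upwards [Lp.coeFn_sub (liftL2 a) M.responseL2, M.memLp_response.coeFn_toLp,
    Lp.coeFn_compMeasurePreserving a measurePreserving_fst_law] with z hsub hY hlift
  have h : (liftL2 a - M.responseL2 : Lp ℝ 2 M.law) z = a z.1 - z.2 := by
    rw [hsub, Pi.sub_apply]
    exact congrArg₂ (· - ·) hlift hY
  simp only [h, real_inner_self_eq_norm_sq, Real.norm_eq_abs, sq_abs]

/-- The functional `a ↦ E ξ a(X)` on `L²(μ)`. -/
noncomputable def noiseMean (fstar : M.V) : Lp ℝ 2 M.μ →L[ℝ] ℝ :=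
  innerSL ℝ (liftL2 (M.toL2 fstar) - M.responseL2) ∘L liftL2.toContinuousLinearMap

theorem noiseMean_toL2_sub (fstar f : M.V) :
    noiseMean fstar (M.toL2 f - M.toL2 fstar)
      = ∫ z, M.noise fstar z * ((f : 𝓧 → ℝ) z.1 - (fstar : 𝓧 → ℝ) z.1) ∂M.law := by
  change inner ℝ (liftL2 (M.toL2 fstar) - M.responseL2) (liftL2 (M.toL2 f - M.toL2 fstar)) = _
  rw [L2.inner_def]
  refine integral_congr_ae ?_
  filter_upwards [liftL2_sub_responseL2_coe fstar, liftL2_toL2_sub_coe f fstar] with z hξ hf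
  rw [hξ, hf]
  exact mul_comm _ _

theorem convex_hull (H : Set M.V) : Convex ℝ (M.hull H) := (convex_convexHull ℝ _).closure

-- `f*` represents the metric projection of `Y` onto the convex set of the `a(X)`, `a` in the hull.
theorem IsTarget.noiseMean_nonneg (htarget : M.IsTarget H fstar) {a : Lp ℝ 2 M.μ}
    (ha : a ∈ M.hull H) : 0 ≤ noiseMean fstar (a - M.toL2 fstar) := by
  let K : Set (Lp ℝ 2 M.law) := liftL2 '' M.hull H
  have hK : Convex ℝ K := (convex_hull H).linear_image liftL2.toLinearMap
  have hmem : liftL2 (M.toL2 fstar) ∈ K := Set.mem_image_of_mem _ htarget.1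
  have hmin : ‖M.responseL2 - liftL2 (M.toL2 fstar)‖
      = ⨅ b : K, ‖M.responseL2 - (b : Lp ℝ 2 M.law)‖ := by
    have : Nonempty K := ⟨⟨_, hmem⟩⟩
    refine le_antisymm (le_ciInf ?_) (ciInf_le
      (f := fun b : K => ‖M.responseL2 - (b : Lp ℝ 2 M.law)‖)
      ⟨0, Set.forall_mem_range.2 fun _ => norm_nonneg _⟩ ⟨_, hmem⟩)
    rintro ⟨_, b, hb, rfl⟩
    have hrisk := htarget.2 b hb
    rw [risk_eq_norm_sq, risk_eq_norm_sq] at hrisk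
    simpa only [norm_sub_rev] using le_of_sq_le_sq hrisk (norm_nonneg _)
  have hinner := (norm_eq_iInf_iff_real_inner_le_zero hK hmem).1 hmin _
    (Set.mem_image_of_mem liftL2 ha)
  rw [← map_sub, ← neg_sub, inner_neg_left, neg_nonpos] at hinner
  exact hinner

end Lift

section LocalizedClass

theorem toL2_lineMap_sub (fstar f : M.V) (t : ℝ) :
    M.toL2 (AffineMap.lineMap fstar f t) - M.toL2 fstar = t • (M.toL2 f - M.toL2 fstar) :=
  add_sub_cancel_right (t • (M.toL2 f - M.toL2 fstar)) _

theorem coe_lineMap_sub (fstar f : M.V) (t : ℝ) (x : 𝓧) :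
    (AffineMap.lineMap fstar f t : M.V).1 x - fstar.1 x = t * (f.1 x - fstar.1 x) :=
  add_sub_cancel_right (t * (f.1 x - fstar.1 x)) _

theorem Psi_nonneg (f : M.V) : 0 ≤ M.Psi f := norm_nonneg _

theorem Psi_lineMap_sub_le (ht : t ∈ Set.Icc (0 : ℝ) 1) :
    M.Psi (AffineMap.lineMap fstar f t) - M.Psi fstar ≤ t * (M.Psi f - M.Psi fstar) := by
  have hD : M.D (AffineMap.lineMap fstar f t) - M.g
      = (1 - t) • (M.D fstar - M.g) + t • (M.D f - M.g) := by
    rw [AffineMap.lineMap_apply_module, map_add, map_smul, map_smul]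
    module
  have hPsi : M.Psi (AffineMap.lineMap fstar f t) ≤ (1 - t) * M.Psi fstar + t * M.Psi f := by
    rw [Psi, hD]
    refine (norm_add_le _ _).trans_eq ?_
    rw [norm_smul, norm_smul, Real.norm_of_nonneg ht.1, Real.norm_of_nonneg (sub_nonneg.2 ht.2)]
    rfl
  linarith

/-- The functions of the closed convex hull of `H` satisfying `Ψ(f) - Ψ(f*) < ρ` and
`‖f - f*‖ < s`. The inequalities are strict, unlike in `penaltyClass` and `localClass`, so that
`MeasurableSuprema` applies to the suprema over this class. -/
def openClass (H : Set M.V) (fstar : M.V) (ρ s : ℝ) : Set M.V :=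
  {f | M.toL2 f ∈ M.hull H ∧ M.Psi f - M.Psi fstar < ρ ∧ ‖M.toL2 f - M.toL2 fstar‖ < s}

theorem openClass_subset_localClass {ρ s : ℝ} {r : ℝ≥0∞} (hr : ENNReal.ofReal s ≤ r) :
    openClass H fstar ρ s ⊆ M.localClass (M.penaltyClass H fstar ρ) fstar r :=
  fun f hf => ⟨⟨hf.1, hf.2.1.le⟩,
    ((ofReal_norm (M.toL2 f - M.toL2 fstar)).ge.trans
      (ENNReal.ofReal_le_ofReal hf.2.2.le)).trans hr⟩

theorem lineMap_mem_openClass {ρ s : ℝ} (hfstar : M.toL2 fstar ∈ M.hull H)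
    (hf : M.toL2 f ∈ M.hull H) (ht : t ∈ Set.Icc (0 : ℝ) 1)
    (hρ : t * (M.Psi f - M.Psi fstar) < ρ) (hs : t * ‖M.toL2 f - M.toL2 fstar‖ < s) :
    AffineMap.lineMap fstar f t ∈ openClass H fstar ρ s := by
  refine ⟨(convex_hull H).lineMap_mem hfstar hf ht, (Psi_lineMap_sub_le ht).trans_lt hρ, ?_⟩
  rwa [toL2_lineMap_sub, norm_smul, Real.norm_of_nonneg ht.1]

-- The cutoffs `min 1 (k * w⁺)` are continuous and increase to the indicator of `0 < w`.
theorem MeasurableSuprema.measurable_iSup_openClass (hmeas : M.MeasurableSuprema H) {m : ℕ}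
    {Φ : (Fin m → 𝓧 × ℝ) → (Fin m → ℝ) × Lp ℝ 2 M.μ × Lp ℝ 2 M.μ → ℝ}
    (hΦm : ∀ v, Measurable fun S => Φ S v) (hΦc : ∀ S, Continuous (Φ S)) (ρ s : ℝ) :
    Measurable fun S : Fin m → 𝓧 × ℝ => ⨆ f : openClass H fstar ρ s,
      ENNReal.ofReal (Φ S (fun i => f.1.1 (S i).1, M.toL2 f.1, M.D f.1)) := by
  let w (v : Lp ℝ 2 M.μ × Lp ℝ 2 M.μ) : ℝ :=
    min (ρ - (‖v.2 - M.g‖ - M.Psi fstar)) (s - ‖v.1 - M.toL2 fstar‖)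
  have hw {f : M.V} (hf : M.toL2 f ∈ M.hull H) :
      0 < w (M.toL2 f, M.D f) ↔ f ∈ openClass H fstar ρ s := by
    simp [w, openClass, Psi, hf]
  let χ (k : ℕ) (v : Lp ℝ 2 M.μ × Lp ℝ 2 M.μ) : ℝ := min 1 (k * max 0 (w v))
  have hcut (k : ℕ) : Measurable fun S : Fin m → 𝓧 × ℝ => ⨆ f ∈ {f : M.V | M.toL2 f ∈ M.hull H},
      ENNReal.ofReal (max 0 (Φ S (fun i => f.1 (S i).1, M.toL2 f, M.D f))
        * χ k (M.toL2 f, M.D f)) := by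
    refine hmeas m (fun S v => max 0 (Φ S v) * χ k v.2)
      (fun v => (measurable_const.max (hΦm v)).mul_const _) fun S => ?_
    have := hΦc S
    simp only [χ, w]
    fun_prop
  convert Measurable.iSup hcut using 1
  funext S
  refine le_antisymm (iSup_le fun f => ?_) (iSup_le fun k => iSup₂_le fun f hf => ?_)
  · have hpos := (hw f.2.1).2 f.2
    obtain ⟨k, hk⟩ := exists_nat_ge (1 / w (M.toL2 f.1, M.D f.1))
    have hχ : χ k (M.toL2 f.1, M.D f.1) = 1 := by
      refine min_eq_left ?_
      rw [max_eq_right hpos.le]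
      exact (div_le_iff₀ hpos).1 hk
    refine le_iSup_of_le k (le_iSup₂_of_le f.1 f.2.1 (ENNReal.ofReal_le_ofReal ?_))
    rw [hχ, mul_one]
    exact le_max_right _ _
  · by_cases hpos : 0 < w (M.toL2 f, M.D f)
    · refine le_iSup_of_le ⟨f, (hw hf).1 hpos⟩ ?_
      refine (ENNReal.ofReal_le_ofReal
        (mul_le_of_le_one_right (le_max_left _ _) (min_le_left _ _))).trans_eq ?_
      simp
    · simp [χ, max_eq_left (not_lt.1 hpos)]

theorem MeasurableSuprema.measurableSups (hmeas : M.MeasurableSuprema H) {K : ℝ≥0} {φ : ℝ → ℝ}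
    (hφ : LipschitzWith K φ) (hφ₀ : φ 0 = 0) (ρ s : ℝ) :
    MeasurableSups M.law fun (f : openClass H fstar ρ s) z => φ (f.1.1 z.1 - fstar.1 z.1) := by
  intro m a c
  have hint (f : M.V) : ∫ z, φ (f.1 z.1 - fstar.1 z.1) ∂M.law
      = ∫ z, φ (liftL2 (M.toL2 f - M.toL2 fstar) z) ∂M.law :=
    integral_congr_ae ((liftL2_toL2_sub_coe f fstar).fun_comp φ).symm
  simp only [hint]
  have hcont := continuous_integral_lipschitz_comp (μ := M.law) hφ hφ₀
  refine hmeas.measurable_iSup_openClass (Φ := fun S v =>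
    c * ∫ z, φ (liftL2 (v.2.1 - M.toL2 fstar) z) ∂M.law
      + ∑ i, a i * φ (v.1 i - fstar.1 (S i).1)) (fun v => ?_) (fun S => ?_) ρ s
  · have := M.measurable_of_mem _ fstar.2
    have := hφ.continuous.measurable
    fun_prop
  · have := hφ.continuous
    refine .add (continuous_const.mul (hcont.comp (liftL2.continuous.comp (by fun_prop)))) ?_
    fun_prop

end LocalizedClass

section QuadraticProcess

variable {n : ℕ} {κ ε ρ s : ℝ}

instance : IsProbabilityMeasure (M.sampleLaw n) :=
  inferInstanceAs (IsProbabilityMeasure (Measure.pi fun _ => M.law))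

/-- The quadratic process `f ↦ n⁻¹ ∑ (f - f*)(Xᵢ)²`. -/
noncomputable def quadProcess (fstar f : M.V) (S : Fin n → 𝓧 × ℝ) : ℝ :=
  (n : ℝ)⁻¹ * ∑ i, (f.1 (S i).1 - fstar.1 (S i).1) ^ 2

theorem quadProcess_nonneg (fstar f : M.V) (S : Fin n → 𝓧 × ℝ) : 0 ≤ quadProcess fstar f S := by
  unfold quadProcess
  positivity

theorem quadProcess_lineMap (fstar f : M.V) (S : Fin n → 𝓧 × ℝ) (t : ℝ) :
    quadProcess fstar (AffineMap.lineMap fstar f t) S = t ^ 2 * quadProcess fstar f S := by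
  simp only [quadProcess, coe_lineMap_sub, mul_pow, ← mul_sum]
  ring

theorem SmallBall.le_law (hSB : M.SmallBall (M.hull H) κ ε) (hfstar : M.toL2 fstar ∈ M.hull H)
    (hf : M.toL2 f ∈ M.hull H) : ENNReal.ofReal ε
      ≤ M.law {z | κ * ‖M.toL2 f - M.toL2 fstar‖ ≤ |f.1 z.1 - fstar.1 z.1|} := by
  have hfm := M.measurable_of_mem _ f.2
  have hfstarm := M.measurable_of_mem _ fstar.2
  refine (hSB _ hf _ hfstar).trans_eq ?_
  refine Eq.trans ?_ (measurePreserving_fst_law.measure_preimage (measurableSet_le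
    measurable_const (hfm.sub hfstarm).abs).nullMeasurableSet).symm
  refine measure_congr ?_
  filter_upwards [(M.memLp_of_mem _ f.2).coeFn_toLp, (M.memLp_of_mem _ fstar.2).coeFn_toLp]
    with x hx hxstar
  refine propext ?_
  change κ * _ ≤ |M.toL2 f x - M.toL2 fstar x| ↔ _
  rw [toL2, hx, toL2, hxstar]
  rfl

theorem lintegral_iSup_sign_openClass_le :
    ∫⁻ p, ⨆ f : openClass H fstar ρ s,
        ENNReal.ofReal (∑ i, sign (p.1 i) * (f.1.1 (p.2 i).1 - fstar.1 (p.2 i).1))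
        ∂M.signSampleLaw n
      ≤ n * ∫⁻ p, M.radSup n (M.penaltyClass H fstar ρ) fstar (ENNReal.ofReal s) p
          ∂M.signSampleLaw n := by
  rw [← lintegral_const_mul' _ _ (ENNReal.natCast_ne_top n)]
  refine lintegral_mono fun p => iSup_le fun f => ?_
  refine le_trans ?_ (mul_le_mul_right
    (le_iSup₂_of_le f.1 (openClass_subset_localClass le_rfl f.2) le_rfl) _)
  rcases n.eq_zero_or_pos with rfl | hn
  · simp
  · rw [← Real.enorm_natCast, ← enorm_mul, mul_inv_cancel_left₀ (by positivity)]
    exact Real.ofReal_le_enorm _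

theorem SmallBall.exists_event_quadProcess_ge (hSB : M.SmallBall (M.hull H) κ ε) (hκ : 0 < κ)
    (hε : 0 ≤ ε) (hmeas : M.MeasurableSuprema H) (hfstar : M.toL2 fstar ∈ M.hull H) (hρ : 0 < ρ)
    (hs : 0 < s) (hrad : ∫⁻ p, M.radSup n (M.penaltyClass H fstar ρ) fstar (ENNReal.ofReal s) p
      ∂M.signSampleLaw n ≤ ENNReal.ofReal (κ * ε / 32 * s)) :
    ∃ A, MeasurableSet A ∧ 1 - Real.exp (-(n * ε ^ 2 / 2)) ≤ (M.sampleLaw n).real A ∧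
      ∀ S ∈ A, ∀ f : M.V, M.toL2 f ∈ M.hull H → M.Psi f - M.Psi fstar < ρ →
        s ≤ ‖M.toL2 f - M.toL2 fstar‖ →
        κ ^ 2 * ε / 4 * ‖M.toL2 f - M.toL2 fstar‖ ^ 2 ≤ quadProcess fstar f S := by
  let a : ℝ := κ * s / 2
  have ha : 0 < a := by positivity
  have hLip : LipschitzWith (2 * a).toNNReal (truncSq a) := LipschitzWith.of_dist_le' fun x y => by
    simpa only [Real.dist_eq, ← mul_sub, abs_mul, abs_two, abs_of_pos ha]
      using abs_truncSq_sub_le ha.le x y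
  have hrad' := lintegral_iSup_sign_openClass_le.trans (mul_le_mul_right hrad n)
  rw [← ENNReal.ofReal_natCast, ← ENNReal.ofReal_mul (by positivity),
    show (n : ℝ) * (κ * ε / 32 * s) = n * (a * ε / 16) by simp only [a]; ring] at hrad'
  obtain ⟨A, hA, hprob, hquad⟩ := exists_event_small_ball (n := n) ha hε
    (fun f : openClass H fstar ρ s => ((M.measurable_of_mem _ f.1.2).sub
      (M.measurable_of_mem _ fstar.2)).comp measurable_fst)
    (hmeas.measurableSups .id rfl ρ s) (hmeas.measurableSups hLip (by simp [truncSq, ha.le]) ρ s)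
    hrad'
  refine ⟨A, hA, hprob, fun S hS f hf hfρ hfs => ?_⟩
  -- Shrinking `f` towards `f*` scales both sides by the same factor.
  have hd : 0 < ‖M.toL2 f - M.toL2 fstar‖ := hs.trans_le hfs
  let t : ℝ := s / (2 * ‖M.toL2 f - M.toL2 fstar‖)
  have ht : 0 < t := by positivity
  have htd : t * ‖M.toL2 f - M.toL2 fstar‖ = s / 2 := by simp only [t]; field_simp
  have ht1 : t ≤ 1 := (div_le_one (by positivity)).2 (by linarith)
  have hmem := lineMap_mem_openClass (ρ := ρ) (s := s) hfstar hf ⟨ht.le, ht1⟩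
    ((mul_lt_mul_of_pos_left hfρ ht).trans_le (mul_le_of_le_one_left hρ.le ht1)) (by linarith)
  have hball := hSB.le_law hfstar hmem.1
  rw [toL2_lineMap_sub, norm_smul, Real.norm_of_nonneg ht.le, htd, ← mul_div_assoc] at hball
  have hshrunk : a ^ 2 * ε / 4 ≤ t ^ 2 * quadProcess fstar f S := by
    rw [← quadProcess_lineMap]
    exact hquad S hS ⟨_, hmem⟩ hball
  refine le_of_mul_le_mul_left (hshrunk.trans' (le_of_eq ?_)) (pow_pos ht 2)
  rw [show a = κ * (t * ‖M.toL2 f - M.toL2 fstar‖) by rw [htd]; exact mul_div_assoc _ _ _]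
  ring

theorem exists_lt_of_rQ_lt {G : Set M.V} {τ b : ℝ}
    (h : M.rQ n G fstar τ < ENNReal.ofReal b) : ∃ s, 0 < s ∧ s < b ∧
      ∫⁻ p, M.radSup n G fstar (ENNReal.ofReal s) p ∂M.signSampleLaw n
        ≤ ENNReal.ofReal (τ * s) := by
  obtain ⟨_, ⟨s, ⟨hs, hrad⟩, rfl⟩, hsb⟩ := sInf_lt_iff.1 h
  exact ⟨s, hs, (ENNReal.ofReal_lt_ofReal_iff_of_nonneg hs.le).1 hsb, hrad⟩

theorem SmallBall.exists_event_quadProcess_ge_of_rQ_le (hSB : M.SmallBall (M.hull H) κ ε)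
    (hκ : 0 < κ) (hε : 0 ≤ ε) (hmeas : M.MeasurableSuprema H) (hfstar : M.toL2 fstar ∈ M.hull H)
    (hρ : 0 < ρ) {r : ℝ≥0∞} (hr : M.rQ n (M.penaltyClass H fstar ρ) fstar (κ * ε / 32) ≤ r) :
    ∃ A, MeasurableSet A ∧ 1 - Real.exp (-(n * ε ^ 2 / 2)) ≤ (M.sampleLaw n).real A ∧
      ∀ S ∈ A, ∀ f : M.V, M.toL2 f ∈ M.hull H → M.Psi f - M.Psi fstar < ρ →
        r < ‖M.toL2 f - M.toL2 fstar‖ₑ →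
        κ ^ 2 * ε / 4 * ‖M.toL2 f - M.toL2 fstar‖ ^ 2 ≤ quadProcess fstar f S := by
  rcases eq_or_ne r ∞ with rfl | hrtop
  · refine ⟨.univ, .univ, ?_, fun S _ f _ _ h => absurd h not_top_lt⟩
    rw [probReal_univ]
    linarith [Real.exp_pos (-(n * ε ^ 2 / 2))]
  have hrj (j : ℕ) : M.rQ n (M.penaltyClass H fstar ρ) fstar (κ * ε / 32)
      < ENNReal.ofReal (r.toReal + 1 / (j + 1)) :=
    hr.trans_lt ((ENNReal.lt_ofReal_iff_toReal_lt hrtop).2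
      (lt_add_of_pos_right _ Nat.one_div_pos_of_nat))
  choose s hs hsr hrad using fun j => exists_lt_of_rQ_lt (hrj j)
  choose A hA hprob hquad using fun j =>
    hSB.exists_event_quadProcess_ge hκ hε hmeas hfstar hρ (hs j) (hrad j)
  refine ⟨limsup A atTop, .measurableSet_limsup hA, le_measureReal_limsup hA hprob, ?_⟩
  intro S hS f hf hfρ hfr
  rw [← ofReal_norm, ENNReal.lt_ofReal_iff_toReal_lt hrtop] at hfr
  have hclose : ∀ᶠ j : ℕ in atTop, r.toReal + 1 / (j + 1) < ‖M.toL2 f - M.toL2 fstar‖ := by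
    refine (tendsto_one_div_add_atTop_nhds_zero_nat.const_add _).eventually_lt_const ?_
    rwa [add_zero]
  obtain ⟨j, hjS, hj⟩ := ((mem_limsup_iff_frequently_mem.1 hS).and_eventually hclose).exists
  exact hquad j S hjS f hf hfρ ((hsr j).trans hj).le

end QuadraticProcess

section MultiplierProcess

variable {n : ℕ} {δ τ ρ s : ℝ} {r : ℝ → ℝ≥0∞}

/-- The product `ξ (f - f*)(X)`, whose empirical mean is the multiplier process. -/
def noiseMul (fstar f : M.V) (z : 𝓧 × ℝ) : ℝ := M.noise fstar z * (f.1 z.1 - fstar.1 z.1)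

theorem noiseMul_lineMap (fstar f : M.V) (t : ℝ) (z : 𝓧 × ℝ) :
    noiseMul fstar (AffineMap.lineMap fstar f t) z = t * noiseMul fstar f z := by
  rw [noiseMul, coe_lineMap_sub, noiseMul, mul_left_comm]

theorem abs_le_div_of_forall_openClass {ℓ : M.V → ℝ} {b : ℝ}
    (hℓ : ∀ f t, ℓ (AffineMap.lineMap fstar f t) = t * ℓ f)
    (hb : ∀ f ∈ openClass H fstar ρ s, |ℓ f| ≤ b) (hfstar : M.toL2 fstar ∈ M.hull H)
    (hf : M.toL2 f ∈ M.hull H) (ht : t ∈ Set.Ioc (0 : ℝ) 1)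
    (hρ : t * (M.Psi f - M.Psi fstar) < ρ) (hs : t * ‖M.toL2 f - M.toL2 fstar‖ < s) :
    |ℓ f| ≤ b / t := by
  have h := hb _ (lineMap_mem_openClass hfstar hf ⟨ht.1.le, ht.2⟩ hρ hs)
  rw [hℓ, abs_mul, abs_of_pos ht.1] at h
  exact (le_div_iff₀' ht.1).2 h

section VanishingNoise

instance : IsProbabilityMeasure (M.signSampleLaw n) :=
  inferInstanceAs (IsProbabilityMeasure ((signLaw n).prod (M.sampleLaw n)))

theorem eq_zero_of_frequently_forall_openClass {ℓ : M.V → ℝ} {K C : ℝ} {ρ s : ℕ → ℝ}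
    (hℓ : ∀ f t, ℓ (AffineMap.lineMap fstar f t) = t * ℓ f) (hρ₀ : Tendsto ρ atTop (nhds 0))
    (hs : ∀ j, 0 < s j) (hsρ : ∀ j, s j < C * ρ j) (hρ : ∀ j, 0 < ρ j)
    (hb : ∃ᶠ j in atTop, ∀ f ∈ openClass H fstar (ρ j) (s j), |ℓ f| ≤ K * s j ^ 2)
    (hfstar : M.toL2 fstar ∈ M.hull H) (hf : M.toL2 f ∈ M.hull H) : ℓ f = 0 := by
  let D : ℝ := max (‖M.toL2 f - M.toL2 fstar‖ + 1) (C * (M.Psi f - M.Psi fstar))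
  have hdD : ‖M.toL2 f - M.toL2 fstar‖ < D := (lt_add_one _).trans_le (le_max_left _ _)
  have hD : 0 < D := (norm_nonneg _).trans_lt hdD
  have hs₀ : Tendsto s atTop (nhds 0) := by
    refine squeeze_zero (fun j => (hs j).le) (fun j => (hsρ j).le) ?_
    simpa using hρ₀.const_mul C
  have hbound : ∃ᶠ j in atTop, |ℓ f| ≤ K * D * s j := by
    refine (hb.and_eventually (hs₀.eventually_lt_const hD)).mono fun j ⟨hj, hsD⟩ => ?_
    refine (abs_le_div_of_forall_openClass (t := s j / D) hℓ hj hfstar hf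
      ⟨div_pos (hs j) hD, (div_le_one hD).2 hsD.le⟩ ?_ ?_).trans_eq ?_
    · rw [div_mul_eq_mul_div, div_lt_iff₀ hD]
      rcases le_or_gt (M.Psi f - M.Psi fstar) 0 with hΨ | hΨ
      · exact (mul_nonpos_of_nonneg_of_nonpos (hs j).le hΨ).trans_lt (mul_pos (hρ j) hD)
      · calc s j * (M.Psi f - M.Psi fstar) < C * ρ j * (M.Psi f - M.Psi fstar) :=
              mul_lt_mul_of_pos_right (hsρ j) hΨ
          _ = ρ j * (C * (M.Psi f - M.Psi fstar)) := by ring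
          _ ≤ ρ j * D := mul_le_mul_of_nonneg_left (le_max_right _ _) (hρ j).le
    · rw [div_mul_eq_mul_div, div_lt_iff₀ hD]
      exact mul_lt_mul_of_pos_left hdD (hs j)
    · have := (hs j).ne'
      field_simp
  have hlim : Tendsto (fun j => K * D * s j) atTop (nhds 0) := by
    simpa using hs₀.const_mul (K * D)
  exact abs_nonpos_iff.1 (ge_of_tendsto_of_frequently hlim hbound)

theorem MeasurableSuprema.measurable_iSup_sign_noiseMul (hmeas : M.MeasurableSuprema H)
    (ρ s : ℝ) : Measurable fun p : (Fin n → Bool) × (Fin n → 𝓧 × ℝ) =>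
      ⨆ f : openClass H fstar ρ s,
        ENNReal.ofReal |∑ i, sign (p.1 i) * noiseMul fstar f (p.2 i)| := by
  refine measurable_from_prod_countable_right fun σ => hmeas.measurable_iSup_openClass
    (Φ := fun S v => |∑ i, sign (σ i) * (M.noise fstar (S i) * (v.1 i - fstar.1 (S i).1))|)
    (fun v => ?_) (fun S => by fun_prop) ρ s
  have := M.measurable_of_mem _ fstar.2
  have := measurable_noise fstar
  fun_prop

theorem abs_sum_sign_noiseMul_le_of_phi_le (hτ : 0 ≤ τ)
    {p : (Fin n → Bool) × (Fin n → 𝓧 × ℝ)} (hf : f ∈ openClass H fstar ρ s)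
    (hp : M.phi n (M.penaltyClass H fstar ρ) fstar (ENNReal.ofReal s) p
      ≤ ENNReal.ofReal (τ * s ^ 2 * √(n : ℝ))) :
    |∑ i, sign (p.1 i) * noiseMul fstar f (p.2 i)| ≤ τ * n * s ^ 2 := by
  have hphi := (le_iSup₂_of_le f (openClass_subset_localClass le_rfl hf) le_rfl).trans hp
  rw [Real.enorm_eq_ofReal_abs, ENNReal.ofReal_le_ofReal_iff (by positivity), abs_mul] at hphi
  rcases n.eq_zero_or_pos with rfl | hn
  · simp
  · rw [abs_of_pos (by positivity), inv_mul_le_iff₀ (by positivity)] at hphi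
    simp only [noiseMul, ← mul_assoc]
    refine hphi.trans_eq ?_
    linear_combination τ * s ^ 2 * Real.mul_self_sqrt n.cast_nonneg

theorem MeasurableSuprema.exists_event_sign_noiseMul_le (hmeas : M.MeasurableSuprema H)
    (hτ : 0 ≤ τ) {b : ℝ}
    (h : M.rM n (M.penaltyClass H fstar ρ) fstar τ δ < ENNReal.ofReal b) :
    ∃ s, 0 < s ∧ s < b ∧ ∃ B, MeasurableSet B ∧ 1 - δ ≤ (M.signSampleLaw n).real B ∧
      ∀ p ∈ B, ∀ f ∈ openClass H fstar ρ s,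
        |∑ i, sign (p.1 i) * noiseMul fstar f (p.2 i)| ≤ τ * n * s ^ 2 := by
  obtain ⟨_, ⟨s, ⟨hs, hprob⟩, rfl⟩, hsb⟩ := sInf_lt_iff.1 h
  let N (p : (Fin n → Bool) × (Fin n → 𝓧 × ℝ)) : ℝ≥0∞ := ⨆ f : openClass H fstar ρ s,
    ENNReal.ofReal |∑ i, sign (p.1 i) * noiseMul fstar f (p.2 i)|
  refine ⟨s, hs, (ENNReal.ofReal_lt_ofReal_iff_of_nonneg hs.le).1 hsb,
    {p | N p ≤ ENNReal.ofReal (τ * n * s ^ 2)},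
    measurableSet_le (hmeas.measurable_iSup_sign_noiseMul ρ s) measurable_const,
    (ENNReal.ofReal_le_iff_le_toReal (measure_ne_top _ _)).1 (hprob.trans (measure_mono ?_)), ?_⟩
  · exact fun p hp => iSup_le fun f => ENNReal.ofReal_le_ofReal
      (abs_sum_sign_noiseMul_le_of_phi_le hτ f.2 hp)
  · intro p hp f hf
    exact (ENNReal.ofReal_le_ofReal_iff (by positivity)).1 ((le_iSup (fun f : openClass H fstar ρ s
      => ENNReal.ofReal |∑ i, sign (p.1 i) * noiseMul fstar f (p.2 i)|) ⟨f, hf⟩).trans hp)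

theorem MeasurableSuprema.measurableSet_noiseMul_eq_zero (hmeas : M.MeasurableSuprema H) :
    MeasurableSet {S : Fin n → 𝓧 × ℝ |
      ∀ f, M.toL2 f ∈ M.hull H → ∀ i, noiseMul fstar f (S i) = 0} := by
  have hsup := hmeas n (fun S v => ∑ i, |M.noise fstar (S i) * (v.1 i - fstar.1 (S i).1)|)
    (fun v => by
      have := M.measurable_of_mem _ fstar.2
      have := measurable_noise fstar
      fun_prop) (fun S => by fun_prop)
  convert hsup (measurableSet_singleton 0) using 1
  ext S
  have hsum (f : M.V) : ∑ i, |noiseMul fstar f (S i)| ≤ 0 ↔ ∀ i, noiseMul fstar f (S i) = 0 := by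
    rw [(sum_nonneg fun i _ => abs_nonneg _).ge_iff_eq',
      sum_eq_zero_iff_of_nonneg fun i _ => abs_nonneg _]
    simp only [mem_univ, abs_eq_zero, forall_const]
  simp only [Set.mem_preimage, Set.mem_singleton_iff, ENNReal.iSup_eq_zero,
    ENNReal.ofReal_eq_zero, Set.mem_ofPred_eq, ← hsum]
  rfl

-- A nonzero vector has a vanishing random signed sum with probability at most `1/2`.
theorem MeasurableSuprema.exists_event_noiseMul_eq_zero_of_sign (hmeas : M.MeasurableSuprema H)
    {U : Set ((Fin n → Bool) × (Fin n → 𝓧 × ℝ))} (hU : MeasurableSet U)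
    (hUprob : 1 - δ ≤ (M.signSampleLaw n).real U)
    (hUzero : ∀ p ∈ U, ∀ f, M.toL2 f ∈ M.hull H →
      ∑ i, sign (p.1 i) * noiseMul fstar f (p.2 i) = 0) :
    ∃ A, MeasurableSet A ∧ 1 - 2 * δ ≤ (M.sampleLaw n).real A ∧
      ∀ S ∈ A, ∀ f, M.toL2 f ∈ M.hull H → ∀ i, noiseMul fstar f (S i) = 0 := by
  have hA := hmeas.measurableSet_noiseMul_eq_zero (fstar := fstar) (n := n)
  refine ⟨_, hA, ?_, fun S hS => hS⟩
  have hhalf : (M.signSampleLaw n).real U ≤ (1 + (M.sampleLaw n).real _) / 2 :=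
    measureReal_prod_le_of_section_le_half (μ := signLaw n) hU hA fun S hS => by
      rw [Set.mem_ofPred_eq] at hS
      push Not at hS
      obtain ⟨f, hf, i, hi⟩ := hS
      exact (measure_mono fun σ hσ => hUzero (σ, S) hσ f hf).trans
        (signLaw_sum_sign_eq_zero_le (c := fun j => noiseMul fstar f (S j))
          fun h => hi (congrFun h i))
  linarith

theorem MeasurableSuprema.exists_event_noiseMul_eq_zero (hmeas : M.MeasurableSuprema H)
    (hfstar : M.toL2 fstar ∈ M.hull H) (hτ : 0 ≤ τ) {C : ℝ} (hC : 0 ≤ C)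
    (hr : ∃ᶠ ρ in nhdsWithin 0 (Set.Ioi 0),
      M.rM n (M.penaltyClass H fstar ρ) fstar τ δ ≤ ENNReal.ofReal (C * ρ)) :
    ∃ A, MeasurableSet A ∧ 1 - 2 * δ ≤ (M.sampleLaw n).real A ∧
      ∀ S ∈ A, ∀ f, M.toL2 f ∈ M.hull H → ∀ i, noiseMul fstar f (S i) = 0 := by
  obtain ⟨ρ, hρlim, hρ⟩ :=
    exists_seq_forall_of_frequently (hr.and_eventually self_mem_nhdsWithin)
  have hrj (j : ℕ) : M.rM n (M.penaltyClass H fstar (ρ j)) fstar τ δ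
      < ENNReal.ofReal ((C + 1) * ρ j) := by
    have hρj : 0 < ρ j := (hρ j).2
    exact (hρ j).1.trans_lt ((ENNReal.ofReal_lt_ofReal_iff (by positivity)).2 (by linarith))
  choose s hs hsρ B hB hBprob hBle using fun j => hmeas.exists_event_sign_noiseMul_le hτ (hrj j)
  refine hmeas.exists_event_noiseMul_eq_zero_of_sign (.measurableSet_limsup hB)
    (le_measureReal_limsup hB hBprob) fun p hp f hf => ?_
  refine eq_zero_of_frequently_forall_openClass
    (ℓ := fun f => ∑ i, sign (p.1 i) * noiseMul fstar f (p.2 i)) (K := τ * n) (fun f t => ?_)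
    (hρlim.mono_right nhdsWithin_le_nhds) hs hsρ (fun j => (hρ j).2)
    ((mem_limsup_iff_frequently_mem.1 hp).mono fun j hj => hBle j p hj) hfstar hf
  simp only [noiseMul_lineMap, mul_left_comm _ t, ← mul_sum]

end VanishingNoise

/-- The multiplier process `f ↦ n⁻¹ ∑ ξᵢ (f - f*)(Xᵢ)`. -/
noncomputable def multProcess (fstar f : M.V) (S : Fin n → 𝓧 × ℝ) : ℝ :=
  (n : ℝ)⁻¹ * ∑ i, noiseMul fstar f (S i)

/-- The deviation of the multiplier process from its mean `E ξ (f - f*)(X)`. -/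
noncomputable def multDeviation (fstar f : M.V) (S : Fin n → 𝓧 × ℝ) : ℝ :=
  multProcess fstar f S - noiseMean fstar (M.toL2 f - M.toL2 fstar)

theorem multDeviation_lineMap (fstar f : M.V) (S : Fin n → 𝓧 × ℝ) (t : ℝ) :
    multDeviation fstar (AffineMap.lineMap fstar f t) S = t * multDeviation fstar f S := by
  simp only [multDeviation, multProcess, noiseMul_lineMap, ← mul_sum, toL2_lineMap_sub, map_smul,
    smul_eq_mul]
  ring

section DeviationBound

variable {lam : ℝ}

theorem abs_le_of_frequently_forall_openClass {ℓ : M.V → ℝ} {K : ℝ} {ρ : ℕ → ℝ}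
    (hℓ : ∀ f t, ℓ (AffineMap.lineMap fstar f t) = t * ℓ f) (hρ₀ : Tendsto ρ atTop (nhds 0))
    (hρ : ∀ k, 0 < ρ k)
    (hb : ∃ᶠ k in atTop, ∀ f ∈ openClass H fstar (ρ k) (k * ρ k), |ℓ f| ≤ K * ρ k)
    (hfstar : M.toL2 fstar ∈ M.hull H) (hf : M.toL2 f ∈ M.hull H) :
    |ℓ f| ≤ K * max (M.Psi f - M.Psi fstar) 0 := by
  have hψ (ψ : ℝ) (hψ : max (M.Psi f - M.Psi fstar) 0 < ψ) : |ℓ f| ≤ K * ψ := by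
    obtain ⟨hfψ, hψ₀⟩ := max_lt_iff.1 hψ
    have hlarge : ∀ᶠ k : ℕ in atTop, ‖M.toL2 f - M.toL2 fstar‖ / ψ < k :=
      tendsto_natCast_atTop_atTop.eventually_gt_atTop _
    obtain ⟨k, hk, hρψ, hkψ⟩ :=
      (hb.and_eventually ((hρ₀.eventually_lt_const hψ₀).and hlarge)).exists
    refine (abs_le_div_of_forall_openClass (t := ρ k / ψ) hℓ hk hfstar hf
      ⟨div_pos (hρ k) hψ₀, (div_le_one hψ₀).2 hρψ.le⟩ ?_ ?_).trans_eq ?_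
    · rw [div_mul_eq_mul_div, div_lt_iff₀ hψ₀]
      exact mul_lt_mul_of_pos_left hfψ (hρ k)
    · rw [div_mul_eq_mul_div, mul_div_assoc, mul_comm (k : ℝ)]
      exact mul_lt_mul_of_pos_left hkψ (hρ k)
    · have := (hρ k).ne'
      field_simp
  have hlim := (continuous_const_mul K).continuousWithinAt
    (s := Set.Ioi (max (M.Psi f - M.Psi fstar) 0)) (x := max (M.Psi f - M.Psi fstar) 0)
  exact ge_of_tendsto hlim (eventually_mem_nhdsWithin.mono hψ)

theorem MeasurableSuprema.measurable_iSup_multDeviation (hmeas : M.MeasurableSuprema H)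
    (ρ s : ℝ) : Measurable fun S : Fin n → 𝓧 × ℝ =>
      ⨆ f : openClass H fstar ρ s, ENNReal.ofReal |multDeviation fstar f S| := by
  refine hmeas.measurable_iSup_openClass (Φ := fun S v =>
    |(n : ℝ)⁻¹ * ∑ i, M.noise fstar (S i) * (v.1 i - fstar.1 (S i).1)
      - noiseMean fstar (v.2.1 - M.toL2 fstar)|) (fun v => ?_) (fun S => by fun_prop) ρ s
  have := M.measurable_of_mem _ fstar.2
  have := measurable_noise fstar
  fun_prop

theorem gammaO_lt_of_lambda0_lt (hlam : M.lambda0 n H fstar r δ τ < ENNReal.ofReal lam)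
    (hρ : 0 < ρ) : M.gammaO n H fstar r ρ τ δ < ENNReal.ofReal (lam * ρ) := by
  have h := (le_iSup (fun ρ : {ρ : ℝ // 0 < ρ} => M.gammaO n H fstar r ρ τ δ / ENNReal.ofReal ρ)
    ⟨ρ, hρ⟩).trans_lt hlam
  rwa [ENNReal.div_lt_iff (.inl (ENNReal.ofReal_pos.2 hρ).ne') (.inl ENNReal.ofReal_ne_top),
    ← ENNReal.ofReal_mul' hρ.le] at h

theorem MeasurableSuprema.exists_event_multDeviation_le_of_lt (hmeas : M.MeasurableSuprema H)
    (hτ : 0 ≤ τ) (hlam : M.lambda0 n H fstar r δ τ < ENNReal.ofReal lam) (hρ : 0 < ρ)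
    (hs : ENNReal.ofReal s ≤ r ρ) :
    ∃ A, MeasurableSet A ∧ 1 - δ ≤ (M.sampleLaw n).real A ∧
      ∀ S ∈ A, ∀ f ∈ openClass H fstar ρ s, |multDeviation fstar f S| ≤ τ * lam * ρ := by
  obtain ⟨_, ⟨z, ⟨hz, hprob⟩, rfl⟩, hzlt⟩ := sInf_lt_iff.1 (gammaO_lt_of_lambda0_lt hlam hρ)
  have hzle : z ≤ lam * ρ := ((ENNReal.ofReal_lt_ofReal_iff_of_nonneg hz.le).1 hzlt).le
  have hbound : 0 ≤ τ * lam * ρ := by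
    rw [mul_assoc]
    exact mul_nonneg hτ (hz.le.trans hzle)
  let O (S : Fin n → 𝓧 × ℝ) : ℝ≥0∞ :=
    ⨆ f : openClass H fstar ρ s, ENNReal.ofReal |multDeviation fstar f S|
  refine ⟨{S | O S ≤ ENNReal.ofReal (τ * lam * ρ)},
    measurableSet_le (hmeas.measurable_iSup_multDeviation ρ s) measurable_const,
    (ENNReal.ofReal_le_iff_le_toReal (measure_ne_top _ _)).1 (hprob.trans (measure_mono ?_)), ?_⟩
  · intro S hS
    change O S ≤ _
    refine iSup_le fun f => ?_
    have hdev : ENNReal.ofReal |multDeviation fstar f.1 S| ≤ M.multSup n H fstar r ρ S := by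
      rw [multDeviation, noiseMean_toL2_sub, ← Real.enorm_eq_ofReal_abs]
      exact le_iSup₂_of_le f.1 (openClass_subset_localClass hs f.2) le_rfl
    refine (hdev.trans hS).trans (ENNReal.ofReal_le_ofReal ?_)
    rw [mul_assoc]
    exact mul_le_mul_of_nonneg_left hzle hτ
  · intro S hS f hf
    exact (ENNReal.ofReal_le_ofReal_iff hbound).1 ((le_iSup (fun f : openClass H fstar ρ s =>
      ENNReal.ofReal |multDeviation fstar f.1 S|) ⟨f, hf⟩).trans hS)

theorem MeasurableSuprema.exists_event_multDeviation_le (hmeas : M.MeasurableSuprema H)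
    (hfstar : M.toL2 fstar ∈ M.hull H) (hτ : 0 ≤ τ)
    (hlam : M.lambda0 n H fstar r δ τ < ENNReal.ofReal lam)
    (hr : ∀ C : ℕ, ∀ᶠ ρ in nhdsWithin 0 (Set.Ioi 0), ENNReal.ofReal (C * ρ) < r ρ) :
    ∃ A, MeasurableSet A ∧ 1 - δ ≤ (M.sampleLaw n).real A ∧
      ∀ S ∈ A, ∀ f : M.V, M.toL2 f ∈ M.hull H →
        |multDeviation fstar f S| ≤ τ * lam * max (M.Psi f - M.Psi fstar) 0 := by
  choose ρ hρr hρ hρlt using fun k : ℕ =>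
    ((hr k).and (Ioo_mem_nhdsGT (Nat.one_div_pos_of_nat (n := k)))).exists
  choose A hA hprob hdev using fun k =>
    hmeas.exists_event_multDeviation_le_of_lt hτ hlam (hρ k) (hρr k).le
  refine ⟨limsup A atTop, .measurableSet_limsup hA, le_measureReal_limsup hA hprob,
    fun S hS f hf => abs_le_of_frequently_forall_openClass
      (fun f t => multDeviation_lineMap fstar f S t) ?_ hρ
      ((mem_limsup_iff_frequently_mem.1 hS).mono fun k hk => hdev k S hk) hfstar hf⟩
  exact squeeze_zero (fun k => (hρ k).le) (fun k => (hρlt k).le)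
    tendsto_one_div_add_atTop_nhds_zero_nat

end DeviationBound

-- As `ρ → 0`, either `r ρ = O(ρ)` along a subsequence, and the bound on `r_M` makes all the
-- `ξᵢ (f - f*)(Xᵢ)` vanish, or `r ρ / ρ → ∞`, and the bound on `λ₀` is available for every `f`.
theorem MeasurableSuprema.exists_event_multProcess_ge (hmeas : M.MeasurableSuprema H)
    (htarget : M.IsTarget H fstar) (hδ : 0 ≤ δ) (hτ : 0 ≤ τ) {τ' lam : ℝ} (hτ' : 0 ≤ τ')
    (hlam : M.lambda0 n H fstar r δ τ < ENNReal.ofReal lam)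
    (hr : ∀ ρ, 0 < ρ → M.rM n (M.penaltyClass H fstar ρ) fstar τ' (δ / 4) ≤ r ρ) :
    ∃ A, MeasurableSet A ∧ 1 - δ ≤ (M.sampleLaw n).real A ∧
      ∀ S ∈ A, ∀ f : M.V, M.toL2 f ∈ M.hull H →
        -(τ * lam * max (M.Psi f - M.Psi fstar) 0) ≤ multProcess fstar f S := by
  by_cases hsmall : ∃ C : ℕ, ∃ᶠ ρ in nhdsWithin 0 (Set.Ioi 0), r ρ ≤ ENNReal.ofReal (C * ρ)
  · obtain ⟨C, hC⟩ := hsmall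
    obtain ⟨A, hA, hprob, hzero⟩ := hmeas.exists_event_noiseMul_eq_zero htarget.1 hτ'
      C.cast_nonneg ((hC.and_eventually self_mem_nhdsWithin).mono
        fun ρ hρ => (hr ρ hρ.2).trans hρ.1)
    refine ⟨A, hA, by linarith, fun S hS f hf => ?_⟩
    have hlam₀ : 0 < lam := ENNReal.ofReal_pos.1 (pos_of_gt hlam)
    rw [multProcess, sum_eq_zero fun i _ => hzero S hS f hf i, mul_zero, neg_nonpos]
    exact mul_nonneg (mul_nonneg hτ hlam₀.le) (le_max_right _ _)
  · simp only [not_exists, not_frequently, not_le] at hsmall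
    obtain ⟨A, hA, hprob, hdev⟩ :=
      hmeas.exists_event_multDeviation_le htarget.1 hτ hlam hsmall
    refine ⟨A, hA, hprob, fun S hS f hf => (abs_le.1 (hdev S hS f hf)).1.trans ?_⟩
    exact sub_le_self _ (htarget.noiseMean_nonneg hf)

end MultiplierProcess

section Estimator

variable {n : ℕ} {lam τ : ℝ} {S : Fin n → 𝓧 × ℝ}

theorem informedLoss_sub_informedLoss (fstar f : M.V) :
    M.informedLoss n lam S f - M.informedLoss n lam S fstar
      = quadProcess fstar f S + 2 * multProcess fstar f S + lam * (M.Psi f - M.Psi fstar) := by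
  have hsq : ∑ i, (f.1 (S i).1 - (S i).2) ^ 2 = ∑ i, (fstar.1 (S i).1 - (S i).2) ^ 2
      + ∑ i, (f.1 (S i).1 - fstar.1 (S i).1) ^ 2 + 2 * ∑ i, noiseMul fstar f (S i) := by
    rw [mul_sum, ← sum_add_distrib, ← sum_add_distrib]
    refine sum_congr rfl fun i _ => ?_
    rw [noiseMul, noise]
    ring
  rw [informedLoss, informedLoss, quadProcess, multProcess, hsq]
  ring

theorem IsInformedEstimator.Psi_le_and_quadProcess_le (hf : M.IsInformedEstimator n H lam S f)
    (hfstar : fstar ∈ H) (hlam : 0 < lam) (hτ : τ < 1 / 2)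
    (hmult : -(τ * lam * max (M.Psi f - M.Psi fstar) 0) ≤ multProcess fstar f S) :
    M.Psi f ≤ M.Psi fstar ∧ quadProcess fstar f S ≤ lam * M.Psi fstar := by
  have hbasic : quadProcess fstar f S + 2 * multProcess fstar f S
      + lam * (M.Psi f - M.Psi fstar) ≤ 0 := by
    rw [← informedLoss_sub_informedLoss]
    exact sub_nonpos.2 (hf.2 fstar hfstar)
  have hPsi : M.Psi f ≤ M.Psi fstar := by
    by_contra! hlt
    rw [max_eq_left (sub_nonneg.2 hlt.le)] at hmult
    have hgain : 0 < (1 - 2 * τ) * (lam * (M.Psi f - M.Psi fstar)) :=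
      mul_pos (by linarith) (mul_pos hlam (sub_pos.2 hlt))
    linarith [quadProcess_nonneg fstar f S]
  rw [max_eq_right (sub_nonpos.2 hPsi), mul_zero, neg_zero] at hmult
  exact ⟨hPsi, by linarith [mul_nonneg hlam.le (Psi_nonneg f)]⟩

theorem measurePreserving_sampleLaw {Ω : Type*} [MeasurableSpace Ω] {P : Measure Ω}
    [IsProbabilityMeasure P] {Z : Fin n → Ω → 𝓧 × ℝ} (hZ : ∀ i, Measurable (Z i))
    (hlaw : ∀ i, P.map (Z i) = M.law) (hindep : iIndepFun Z P) :
    MeasurePreserving (fun ω i => Z i ω) P (M.sampleLaw n) where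
  measurable := measurable_pi_lambda _ hZ
  map_eq := by
    rw [(iIndepFun_iff_map_fun_eq_pi_map fun i => (hZ i).aemeasurable).1 hindep]
    simp only [hlaw, sampleLaw]

theorem IsInformedEstimator.toL2_mem_hull (hf : M.IsInformedEstimator n H lam S f) :
    M.toL2 f ∈ M.hull H :=
  subset_closure (subset_convexHull ℝ _ ⟨f, hf.1, rfl⟩)

end Estimator

end Model

end PISL

theorem theorem2_general {𝓧 : Type*} [MeasurableSpace 𝓧] (M : PISL.Model 𝓧)
    (H : Set M.V) (κ ε : ℝ) (hκ : 0 < κ) (hε : 0 < ε)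
    (hSB : M.SmallBall (M.hull H) κ ε)
    (hmeas : M.MeasurableSuprema H)
    (fstar : M.V) (htarget : M.IsTarget H fstar) (hfstar : fstar ∈ H)
    (n : ℕ) (δ : ℝ) (hδ : 0 ≤ δ)
    (r : ℝ → ℝ≥0∞)
    (hr : ∀ ρ : ℝ, 0 < ρ →
      max (M.rM n (M.penaltyClass H fstar ρ) fstar (κ ^ 2 * ε / 80) (δ / 4))
        (M.rQ n (M.penaltyClass H fstar ρ) fstar (κ * ε / 32)) ≤ r ρ)
    (ρ : ℝ) (hρ : 0 < ρ)
    (τ : ℝ) (hτ0 : 0 ≤ τ) (hτ : τ < 1 / 2)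
    (lam : ℝ) (hlam : M.lambda0 n H fstar r δ τ < ENNReal.ofReal lam)
    {Ω : Type*} [MeasurableSpace Ω] (P : Measure Ω) [IsProbabilityMeasure P]
    (Z : Fin n → Ω → 𝓧 × ℝ) (hZ : ∀ i, Measurable (Z i))
    (hlaw : ∀ i, P.map (Z i) = M.law) (hindep : iIndepFun Z P) :
    ∃ A : Set Ω, MeasurableSet A ∧
      1 - δ - Real.exp (-(n * ε ^ 2 / 2)) ≤ P.real A ∧
      ∀ ω ∈ A, ∀ hhat : M.V, M.IsInformedEstimator n H lam (fun i => Z i ω) hhat →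
        M.Psi hhat ≤ M.Psi fstar ∧
        ‖M.toL2 hhat - M.toL2 fstar‖ₑ ≤
          max (r ρ) (ENNReal.ofReal √(4 / (κ ^ 2 * ε) * lam * M.Psi fstar)) := by
  have hradius : 4 / (κ ^ 2 * ε) * lam * M.Psi fstar = lam * M.Psi fstar / (κ ^ 2 * ε / 4) := by
    field_simp
  rw [hradius]
  obtain ⟨A, hA, hPA, hmult⟩ := hmeas.exists_event_multProcess_ge htarget hδ hτ0
    (by positivity : 0 ≤ κ ^ 2 * ε / 80) hlam fun ρ hρ => (le_max_left _ _).trans (hr ρ hρ)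
  obtain ⟨B, hB, hPB, hquad⟩ := hSB.exists_event_quadProcess_ge_of_rQ_le hκ hε.le hmeas
    htarget.1 hρ ((le_max_right _ _).trans (hr ρ hρ))
  have hsample := PISL.Model.measurePreserving_sampleLaw hZ hlaw hindep
  refine ⟨(fun ω i => Z i ω) ⁻¹' (A ∩ B), hsample.measurable (hA.inter hB), ?_, ?_⟩
  · rw [hsample.measureReal_preimage (hA.inter hB).nullMeasurableSet]
    exact PISL.one_sub_sub_le_measureReal_inter hB hPA hPB
  · rintro ω ⟨hωA, hωB⟩ f hf
    obtain ⟨hPsi, hloss⟩ := hf.Psi_le_and_quadProcess_le hfstar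
      (ENNReal.ofReal_pos.1 (pos_of_gt hlam)) hτ (hmult _ hωA f hf.toL2_mem_hull)
    exact ⟨hPsi, PISL.enorm_le_max_of_lt_imp (by positivity) fun hlt =>
      (hquad _ hωB f hf.toL2_mem_hull (by linarith) hlt).trans hloss⟩

theorem theorem2 {𝓧 : Type*} [MeasurableSpace 𝓧] (M : PISL.Model 𝓧)
    -- the class, its closed convex hull and the target
    (H : Set M.V) (κ ε : ℝ) (hκ : 0 < κ) (hε : 0 < ε) (hε1 : ε ≤ 1)
    (hSB : M.SmallBall (M.hull H) κ ε)
    (hmeas : M.MeasurableSuprema H)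
    (fstar : M.V) (htarget : M.IsTarget H fstar) (hfstar : fstar ∈ H)
    -- the sample size, the confidence parameter and the bound on the local complexities
    (n : ℕ) (δ : ℝ) (hδ0 : 0 < δ) (hδ1 : δ < 1)
    (r : ℝ → ℝ≥0∞)
    (hr : ∀ ρ : ℝ, 0 ≤ ρ →
      max (M.rM n (M.penaltyClass H fstar ρ) fstar (κ ^ 2 * ε / 80) (δ / 4))
        (M.rQ n (M.penaltyClass H fstar ρ) fstar (κ * ε / 32)) ≤ r ρ)
    -- the choice of `ρ`, `τ` and of the regularization parameter
    (ρ : ℝ) (hρ : 2 * M.Psi fstar < ρ)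
    (τ : ℝ) (hτ0 : 0 < τ) (hτ : τ < 1 / 2 - M.Psi fstar / ρ)
    (lam : ℝ) (hlam : M.lambda0 n H fstar r δ τ < ENNReal.ofReal lam)
    -- an independent sample of `(X, Y)`
    {Ω : Type*} [MeasurableSpace Ω] (P : Measure Ω) [IsProbabilityMeasure P]
    (Z : Fin n → Ω → 𝓧 × ℝ) (hZ : ∀ i, Measurable (Z i))
    (hlaw : ∀ i, P.map (Z i) = M.law) (hindep : iIndepFun Z P) :
    ∃ A : Set Ω, MeasurableSet A ∧
      1 - 2 * δ - 2 * Real.exp (-(n * ε ^ 2 / 2)) ≤ P.real A ∧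
      ∀ ω ∈ A, ∀ hhat : M.V, M.IsInformedEstimator n H lam (fun i => Z i ω) hhat →
        M.Psi hhat - M.Psi fstar ≤ ρ ∧
        ‖M.toL2 hhat - M.toL2 fstar‖ₑ ≤
          max (r ρ) (ENNReal.ofReal (√(32 / (κ ^ 2 * ε) * lam * M.Psi fstar))) := by
  have hPsi : 0 ≤ M.Psi fstar := PISL.Model.Psi_nonneg fstar
  have hρ₀ : 0 < ρ := by linarith
  have hlam₀ : 0 ≤ lam := (ENNReal.ofReal_pos.1 (pos_of_gt hlam)).le
  obtain ⟨A, hA, hprob, hbound⟩ := theorem2_general M H κ ε hκ hε hSB hmeas fstar htarget hfstar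
    n δ hδ0.le r (fun ρ hρ => hr ρ hρ.le) ρ hρ₀ τ hτ0.le (by linarith [div_nonneg hPsi hρ₀.le])
    lam hlam P Z hZ hlaw hindep
  exact ⟨A, hA, by linarith [Real.exp_pos (-(n * ε ^ 2 / 2))], fun ω hω f hf =>
    ⟨by linarith [(hbound ω hω f hf).1], (hbound ω hω f hf).2.trans (by gcongr; norm_num)⟩⟩
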